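/- **Robust Interval Scheduling is solvable in polynomial time.** An instance consists of $n\ge 0$ jobs $E=\{1,\dots,n\}$; job $j$ is a half-open interval $[a_j,b_j)\subseteq\mathbb R$ with $a_j,b_j\in\mathbb N$, $a_j\le b_j$, and has a weight $w(j)\in\mathbb R_{\ge 0}$. Let $\mathcal F$ be the family of all sets $S\subseteq E$ of jobs whose intervals are pairwise disjoint (equivalently, the stable sets of the interval graph of the given intervals), and put $w(S)=\sum_{j\in S}w(j)$, $S-f=S\setminus\{f\}$, $S+e=S\cup\{e\}$, $S-\emptyset=S+\emptyset=S$. The task is to find an optimal first-stage solution of the $(1,1)$-robust counterpart $$\max_{S\in\mathcal F}\ \min_{f\in E\cup\{\emptyset\}}\ \max_{\substack{e\in (E\setminus(S+f))\cup\{\emptyset\}\\ S-f+e\in\mathcal F}} w(S-f+e),$$ that is, a set $S\in\mathcal F$ at which the outer maximum is attained. There are a program $P$ for a random access machine and a polynomial $p$ such that, for every $n$ and every instance with $n$ jobs, $P$ started on $(n,(a_j)_j,(b_j)_j,(w(j))_j)$ halts after at most $p(n)$ steps and outputs an optimal first-stage solution. Here the machine has variables and indexed arrays holding natural numbers and real numbers;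 its only operations on numbers are addition, subtraction (truncated on natural numbers) and comparison, besides natural-number constants and the real constant $0$; and each elementary operation (constant, memory access, arithmetic operation, comparison, logical connective, assignment) costs one step. -/

import Mathlib

noncomputable section

namespace RobustIntervalScheduling

/-! ## The (1,1)-robust counterpart of a combinatorial optimization problem

The ground set is a finite type `E`, the feasible solutions are a family `F` of finite subsets
of `E`, and the weights are `w : E → ℝ`. The elements of `Option E` stand for `E ∪ {∅}`:
`none` means that no element is deleted (or added). -/

section Robust

variable {E : Type} [Fintype E] [DecidableEq E]

/-- `S - f`, where `f = none` deletes nothing. -/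
def interdict (S : Finset E) (f : Option E) : Finset E := S \ f.toFinset

/-- `S - f + e`, where `f = none` deletes nothing and `e = none` adds nothing. -/
def secondStage (S : Finset E) (f e : Option E) : Finset E := interdict S f ∪ e.toFinset

/-- After the deletion of `f`, the recourse `e` is admissible: `e = none`, or `e` is an element
of `E \ (S + f)`; and in both cases `S - f + e` is feasible. -/
def Admissible (F : Set (Finset E)) (S : Finset E) (f e : Option E) : Prop :=
  (∀ x, e = some x → x ∉ S ∧ f ≠ some x) ∧ secondStage S f e ∈ F

/-- The weight of a set of elements. -/
def totalWeight (w : E → ℝ) (S : Finset E) : ℝ := ∑ x ∈ S, w x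

/-- The worst-case second-stage weight of the first-stage solution `S`,
`min_{f ∈ E ∪ ∅} max_e w(S - f + e)`, the maximum being over the admissible recourse actions `e`.
Both index types are finite. The first is non-empty, and so is the second whenever `S ∈ F` and
`F` is downward-closed (`e = none` is admissible), so that these are a minimum and a maximum. -/
def robustValue (F : Set (Finset E)) (w : E → ℝ) (S : Finset E) : ℝ :=
  ⨅ f : Option E, ⨆ e : {e : Option E // Admissible F S f e},
    totalWeight w (secondStage S f e.1)

/-- `S` is an optimal first-stage solution of
`max_{S ∈ F} min_{f ∈ E ∪ ∅} max_e w(S - f + e)`. -/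
def IsOptimalFirstStage (F : Set (Finset E)) (w : E → ℝ) (S : Finset E) : Prop :=
  S ∈ F ∧ ∀ T ∈ F, robustValue F w T ≤ robustValue F w S

end Robust

/-! ## Interval scheduling -/

/-- An instance of Interval Scheduling with `n` jobs; job `j` is the half-open interval
`[left j, right j)` and has the weight `weight j`. -/
structure Instance (n : ℕ) where
  left : Fin n → ℕ
  right : Fin n → ℕ
  left_le_right : ∀ j, left j ≤ right j
  weight : Fin n → ℝ
  weight_nonneg : ∀ j, 0 ≤ weight j

/-- The half-open interval of job `j`, as a subset of the real line. -/
def Instance.interval {n : ℕ} (I : Instance n) (j : Fin n) : Set ℝ :=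
  Set.Ico (I.left j : ℝ) (I.right j : ℝ)

/-- The feasible solutions: sets of jobs whose intervals are pairwise disjoint. -/
def Instance.feasible {n : ℕ} (I : Instance n) : Set (Finset (Fin n)) :=
  {S | (S : Set (Fin n)).PairwiseDisjoint I.interval}

/-! ## A random access machine

A program works on finitely many natural-number variables and real variables, and on finitely many
arrays of natural numbers and of reals (indexed by natural numbers and initially zero outside of
the input). The only operations on numbers are addition, subtraction and comparison. There is
no multiplication, no real constant but `0`, and no rounding, so that in polynomially many steps
only numbers of polynomial bit length arise from rational data of polynomial bit length.
Every variable access, constant, array access, arithmetic operation, comparison, logical connective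
and assignment costs one step. -/

/-- The memory: the variables and the arrays of both sorts are named by natural numbers. -/
structure State where
  nat : ℕ → ℕ
  natArr : ℕ → ℕ → ℕ
  real : ℕ → ℝ
  realArr : ℕ → ℕ → ℝ

/-- Expressions of sort natural number; `get a i` is the entry `i` of the array `a`. -/
inductive NatExp where
  | const (c : ℕ)
  | var (x : ℕ)
  | get (a : ℕ) (i : NatExp)
  | add (e₁ e₂ : NatExp)
  | sub (e₁ e₂ : NatExp)

/-- The value of an expression; subtraction of natural numbers is truncated. -/
def NatExp.eval (s : State) : NatExp → ℕ
  | const c => c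
  | var x => s.nat x
  | get a i => s.natArr a (i.eval s)
  | add e₁ e₂ => e₁.eval s + e₂.eval s
  | sub e₁ e₂ => e₁.eval s - e₂.eval s

def NatExp.cost : NatExp → ℕ
  | const _ => 1
  | var _ => 1
  | get _ i => i.cost + 1
  | add e₁ e₂ => e₁.cost + e₂.cost + 1
  | sub e₁ e₂ => e₁.cost + e₂.cost + 1

/-- Expressions of sort real; `get a i` is the entry `i` of the array `a`. -/
inductive RealExp where
  | zero
  | var (x : ℕ)
  | get (a : ℕ) (i : NatExp)
  | add (e₁ e₂ : RealExp)
  | sub (e₁ e₂ : RealExp)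

def RealExp.eval (s : State) : RealExp → ℝ
  | zero => 0
  | var x => s.real x
  | get a i => s.realArr a (i.eval s)
  | add e₁ e₂ => e₁.eval s + e₂.eval s
  | sub e₁ e₂ => e₁.eval s - e₂.eval s

def RealExp.cost : RealExp → ℕ
  | zero => 1
  | var _ => 1
  | get _ i => i.cost + 1
  | add e₁ e₂ => e₁.cost + e₂.cost + 1
  | sub e₁ e₂ => e₁.cost + e₂.cost + 1

/-- Tests. -/
inductive Test where
  | natLt (e₁ e₂ : NatExp)
  | realLt (e₁ e₂ : RealExp)
  | not (b : Test)
  | and (b₁ b₂ : Test)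

def Test.Holds (s : State) : Test → Prop
  | natLt e₁ e₂ => e₁.eval s < e₂.eval s
  | realLt e₁ e₂ => e₁.eval s < e₂.eval s
  | not b => ¬ b.Holds s
  | and b₁ b₂ => b₁.Holds s ∧ b₂.Holds s

def Test.cost : Test → ℕ
  | natLt e₁ e₂ => e₁.cost + e₂.cost + 1
  | realLt e₁ e₂ => e₁.cost + e₂.cost + 1
  | not b => b.cost + 1
  | and b₁ b₂ => b₁.cost + b₂.cost + 1

/-- Programs. -/
inductive Program where
  | skip
  | setNat (x : ℕ) (e : NatExp)
  | putNat (a : ℕ) (i : NatExp) (e : NatExp)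
  | setReal (x : ℕ) (e : RealExp)
  | putReal (a : ℕ) (i : NatExp) (e : RealExp)
  | seq (P Q : Program)
  | ite (b : Test) (P Q : Program)
  | while (b : Test) (P : Program)

def State.setNat (s : State) (x v : ℕ) : State :=
  { s with nat := Function.update s.nat x v }

def State.putNat (s : State) (a i v : ℕ) : State :=
  { s with natArr := Function.update s.natArr a (Function.update (s.natArr a) i v) }

def State.setReal (s : State) (x : ℕ) (v : ℝ) : State :=
  { s with real := Function.update s.real x v }

def State.putReal (s : State) (a i : ℕ) (v : ℝ) : State :=
  { s with realArr := Function.update s.realArr a (Function.update (s.realArr a) i v) }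

/-- `Exec P s s' t`: the program `P`, started in the state `s`, halts in the state `s'` after
exactly `t` steps. -/
inductive Exec : Program → State → State → ℕ → Prop where
  | skip (s : State) : Exec .skip s s 1
  | setNat (s : State) (x : ℕ) (e : NatExp) :
      Exec (.setNat x e) s (s.setNat x (e.eval s)) (e.cost + 1)
  | putNat (s : State) (a : ℕ) (i e : NatExp) :
      Exec (.putNat a i e) s (s.putNat a (i.eval s) (e.eval s)) (i.cost + e.cost + 1)
  | setReal (s : State) (x : ℕ) (e : RealExp) :
      Exec (.setReal x e) s (s.setReal x (e.eval s)) (e.cost + 1)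
  | putReal (s : State) (a : ℕ) (i : NatExp) (e : RealExp) :
      Exec (.putReal a i e) s (s.putReal a (i.eval s) (e.eval s)) (i.cost + e.cost + 1)
  | seq {P Q : Program} {s s' s'' : State} {t t' : ℕ} :
      Exec P s s' t → Exec Q s' s'' t' → Exec (.seq P Q) s s'' (t + t')
  | ite_true {b : Test} {P Q : Program} {s s' : State} {t : ℕ} :
      b.Holds s → Exec P s s' t → Exec (.ite b P Q) s s' (b.cost + t)
  | ite_false {b : Test} {P Q : Program} {s s' : State} {t : ℕ} :
      ¬ b.Holds s → Exec Q s s' t → Exec (.ite b P Q) s s' (b.cost + t)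
  | while_true {b : Test} {P : Program} {s s' s'' : State} {t t' : ℕ} :
      b.Holds s → Exec P s s' t → Exec (.while b P) s' s'' t' →
        Exec (.while b P) s s'' (b.cost + t + t')
  | while_false {b : Test} {P : Program} {s : State} :
      ¬ b.Holds s → Exec (.while b P) s s b.cost

/-! ## Input and output -/

/-- The initial memory: the natural-number variable `0` holds the number `n` of jobs, the
natural-number arrays `0` and `1` hold the left and the right end points, the real array `0` holds
the weights, and everything else is zero. -/
def Instance.input {n : ℕ} (I : Instance n) : State where
  nat x := if x = 0 then n else 0
  natArr a i :=
    if h : i < n then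
      if a = 0 then I.left ⟨i, h⟩ else if a = 1 then I.right ⟨i, h⟩ else 0
    else 0
  real _ := 0
  realArr a i := if h : i < n then (if a = 0 then I.weight ⟨i, h⟩ else 0) else 0

/-- The set of jobs that a final memory describes: job `j` is selected if and only if the entry `j`
of the natural-number array `2` is `1`. -/
def output (n : ℕ) (s : State) : Finset (Fin n) :=
  Finset.univ.filter fun j => s.natArr 2 j = 1

end RobustIntervalScheduling

end

noncomputable section

namespace RobustIntervalScheduling

/-! ## State transformers computed in polynomial time -/

/-! Let the loss of a feasible `S` be its weight minus its robust value. The minimum and the maximum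
are attained, so the loss is `w(p) - w(q)` for some `p`, `q`, each a job or nothing: polynomially
many candidates. Robustness then means that every deletion has an answer that keeps the loss within
this bound. A deletion outside `S` is answered by one of two distinct jobs `e₁`, `e₂` (or by
nothing) that are compatible with all of `S`. The deletion of `f ∈ S` is answered by `e₁`, or by a
private replacement `e` compatible with `S - f`.

Take `e₁` heaviest among what can be added to `S`. A private replacement is then needed only if it
meets `f`, so it is squeezed between the neighbours of `f` in the left-to-right order of `S`, and
all compatibilities can be tested on consecutive pairs `(f, e)`. For a fixed guess `(e₁, e₂, p, q)`
the candidates are therefore paths in an acyclic graph on such pairs. Every path set has at most the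
guessed loss (`Jobs.Reach.le_robustValue`), and every feasible set lies on a path for a guess with
exactly its loss (`Jobs.exists_guess`). So the best value of path weight minus guessed loss, over
all guesses, is optimal (`Jobs.nest_tryGuess`).

Heaviest paths are found by rounds of relaxations. The set of a path is stored as a bit mask, a
single number, so that extending a path takes boundedly many steps. Correctness of all nested loops
goes through `nest_spec`. -/

@[simp] theorem State.setNat_nat (s : State) (x v y : ℕ) :
    (s.setNat x v).nat y = if y = x then v else s.nat y := by
  simp [State.setNat, Function.update_apply]

@[simp] theorem State.setNat_natArr (s : State) (x v : ℕ) : (s.setNat x v).natArr = s.natArr := rfl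

@[simp] theorem State.setNat_real (s : State) (x v : ℕ) : (s.setNat x v).real = s.real := rfl

@[simp] theorem State.setNat_realArr (s : State) (x v : ℕ) :
    (s.setNat x v).realArr = s.realArr := rfl

@[simp] theorem State.putNat_natArr (s : State) (a i v b : ℕ) :
    (s.putNat a i v).natArr b =
      if b = a then Function.update (s.natArr a) i v else s.natArr b := by
  simp [State.putNat, Function.update_apply]

@[simp] theorem State.putNat_nat (s : State) (a i v : ℕ) : (s.putNat a i v).nat = s.nat := rfl

@[simp] theorem State.putNat_real (s : State) (a i v : ℕ) : (s.putNat a i v).real = s.real := rfl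

@[simp] theorem State.putNat_realArr (s : State) (a i v : ℕ) :
    (s.putNat a i v).realArr = s.realArr := rfl

@[simp] theorem State.setReal_real (s : State) (x : ℕ) (v : ℝ) (y : ℕ) :
    (s.setReal x v).real y = if y = x then v else s.real y := by
  simp [State.setReal, Function.update_apply]

@[simp] theorem State.setReal_nat (s : State) (x : ℕ) (v : ℝ) : (s.setReal x v).nat = s.nat := rfl

@[simp] theorem State.setReal_natArr (s : State) (x : ℕ) (v : ℝ) :
    (s.setReal x v).natArr = s.natArr := rfl

@[simp] theorem State.setReal_realArr (s : State) (x : ℕ) (v : ℝ) :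
    (s.setReal x v).realArr = s.realArr := rfl

@[simp] theorem State.putReal_realArr (s : State) (a i : ℕ) (v : ℝ) (b : ℕ) :
    (s.putReal a i v).realArr b =
      if b = a then Function.update (s.realArr a) i v else s.realArr b := by
  simp [State.putReal, Function.update_apply]

@[simp] theorem State.putReal_nat (s : State) (a i : ℕ) (v : ℝ) :
    (s.putReal a i v).nat = s.nat := rfl

@[simp] theorem State.putReal_natArr (s : State) (a i : ℕ) (v : ℝ) :
    (s.putReal a i v).natArr = s.natArr := rfl

@[simp] theorem State.putReal_real (s : State) (a i : ℕ) (v : ℝ) :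
    (s.putReal a i v).real = s.real := rfl

attribute [simp] NatExp.eval RealExp.eval Test.Holds

/-- `g` is computed by a program in time polynomial in the natural-number variable `0`, and leaves
the natural-number variables below `l` unchanged. -/
structure PolyTime (l : ℕ) (g : State → State) : Prop where
  exec : ∃ (P : Program) (p : Polynomial ℕ), ∀ s, ∃ t ≤ p.eval (s.nat 0), Exec P s (g s) t
  nat_eq : ∀ s, ∀ i < l, (g s).nat i = s.nat i

namespace PolyTime

variable {l : ℕ} {g h : State → State}

theorem of_le {m : ℕ} (hg : PolyTime l g) (hm : m ≤ l) : PolyTime m g :=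
  ⟨hg.exec, fun s i hi => hg.nat_eq s i (hi.trans_le hm)⟩

theorem skip : PolyTime l fun s => s :=
  ⟨⟨.skip, 1, fun s => ⟨1, by simp, .skip s⟩⟩, fun _ _ _ => rfl⟩

theorem setNat {x : ℕ} (hx : l ≤ x) (e : NatExp) : PolyTime l fun s => s.setNat x (e.eval s) :=
  ⟨⟨.setNat x e, .C (e.cost + 1), fun s => ⟨e.cost + 1, by simp, .setNat s x e⟩⟩,
    fun s i hi => by simp [(hi.trans_le hx).ne]⟩

theorem putNat (a : ℕ) (i e : NatExp) : PolyTime l fun s => s.putNat a (i.eval s) (e.eval s) :=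
  ⟨⟨.putNat a i e, .C (i.cost + e.cost + 1),
    fun s => ⟨i.cost + e.cost + 1, by simp, .putNat s a i e⟩⟩, fun _ _ _ => rfl⟩

theorem setReal (x : ℕ) (e : RealExp) : PolyTime l fun s => s.setReal x (e.eval s) :=
  ⟨⟨.setReal x e, .C (e.cost + 1), fun s => ⟨e.cost + 1, by simp, .setReal s x e⟩⟩,
    fun _ _ _ => rfl⟩

theorem putReal (a : ℕ) (i : NatExp) (e : RealExp) :
    PolyTime l fun s => s.putReal a (i.eval s) (e.eval s) :=
  ⟨⟨.putReal a i e, .C (i.cost + e.cost + 1),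
    fun s => ⟨i.cost + e.cost + 1, by simp, .putReal s a i e⟩⟩, fun _ _ _ => rfl⟩

/-- Since `0 < l`, the first program leaves the variable `0` alone, so both time bounds are
evaluated at the same number. -/
theorem comp (hl : 0 < l) (hh : PolyTime l h) (hg : PolyTime l g) : PolyTime l (h ∘ g) := by
  obtain ⟨P, p, hP⟩ := hg.exec
  obtain ⟨Q, q, hQ⟩ := hh.exec
  refine ⟨⟨.seq P Q, p + q, fun s => ?_⟩, fun s i hi => ?_⟩
  · obtain ⟨t, ht, het⟩ := hP s
    obtain ⟨u, hu, heu⟩ := hQ (g s)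
    rw [hg.nat_eq s 0 hl] at hu
    exact ⟨t + u, by rw [Polynomial.eval_add]; omega, .seq het heu⟩
  · simp [hh.nat_eq _ i hi, hg.nat_eq _ i hi]

open Classical in
theorem ite (b : Test) (hg : PolyTime l g) (hh : PolyTime l h) :
    PolyTime l fun s => if b.Holds s then g s else h s := by
  obtain ⟨P, p, hP⟩ := hg.exec
  obtain ⟨Q, q, hQ⟩ := hh.exec
  refine ⟨⟨.ite b P Q, .C b.cost + p + q, fun s => ?_⟩, fun s i hi => ?_⟩
  · obtain ⟨t, ht, het⟩ := hP s
    obtain ⟨u, hu, heu⟩ := hQ s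
    simp only [Polynomial.eval_add, Polynomial.eval_C]
    by_cases hb : b.Holds s
    · exact ⟨b.cost + t, by omega, by simpa only [if_pos hb] using .ite_true hb het⟩
    · exact ⟨b.cost + u, by omega, by simpa only [if_neg hb] using .ite_false hb heu⟩
  · split_ifs
    exacts [hg.nat_eq s i hi, hh.nat_eq s i hi]

end PolyTime

/-! ### Counting loops and their nesting -/

/-- The state after `k` rounds of the loop `for x = 0, …, n do g`. -/
def loopIter (x : ℕ) (g : State → State) (s : State) : ℕ → State
  | 0 => s.setNat x 0
  | k + 1 => (g (loopIter x g s k)).setNat x (k + 1)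

/-- The loop `for x = 0, …, n do g`, where `n` is the value of the variable `0`. -/
def loop (x : ℕ) (g : State → State) (s : State) : State := loopIter x g s (s.nat 0 + 1)

theorem loopIter_nat_self (x : ℕ) (g : State → State) (s : State) (k : ℕ) :
    (loopIter x g s k).nat x = k := by
  cases k <;> simp [loopIter]

theorem loopIter_nat {x : ℕ} {g : State → State} (hg : PolyTime (x + 1) g) (s : State) (k : ℕ)
    {i : ℕ} (hi : i < x) : (loopIter x g s k).nat i = s.nat i := by
  induction k with
  | zero => simp [loopIter, hi.ne]
  | succ k ih => simp [loopIter, hi.ne, hg.nat_eq _ i (hi.trans x.lt_succ_self), ih]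

theorem PolyTime.loop {x : ℕ} (hx : 0 < x) {g : State → State} (hg : PolyTime (x + 1) g) :
    PolyTime x (loop x g) := by
  obtain ⟨P, p, hP⟩ := hg.exec
  let b : Test := .natLt (.var x) (.add (.var 0) (.const 1))
  let B : Program := .seq P (.setNat x (.add (.var x) (.const 1)))
  -- A round costs 5 for the test and 4 for the increment, besides the body. The initial assignment
  -- (2) and the last, failing test (5) give the 7.
  refine ⟨⟨.seq (.setNat x (.const 0)) (.while b B), (.X + 1) * (p + .C 9) + .C 7, fun s => ?_⟩,
    fun s i hi => loopIter_nat hg s _ hi⟩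
  have key : ∀ m k, k + m = s.nat 0 + 1 → ∃ t ≤ m * (p.eval (s.nat 0) + 9) + 5,
      Exec (.while b B) (loopIter x g s k) (RobustIntervalScheduling.loop x g s) t := by
    intro m
    induction m with
    | zero =>
      intro k hk
      refine ⟨5, by simp, ?_⟩
      rw [show RobustIntervalScheduling.loop x g s = loopIter x g s k by
        rw [RobustIntervalScheduling.loop, ← hk, add_zero]]
      refine Exec.while_false (b := b) ?_
      simp [b, loopIter_nat_self, loopIter_nat hg s k hx]
      omega
    | succ m ih =>
      intro k hk
      obtain ⟨u, hu, heu⟩ := ih (k + 1) (by omega)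
      obtain ⟨t, ht, het⟩ := hP (loopIter x g s k)
      rw [loopIter_nat hg s k hx] at ht
      refine ⟨5 + (t + 4) + u, ?_, Exec.while_true (b := b) ?_ (.seq het ?_) heu⟩
      · rw [add_mul, one_mul]; omega
      · simp [b, loopIter_nat_self, loopIter_nat hg s k hx]
        omega
      · have := Exec.setNat (g (loopIter x g s k)) x (.add (.var x) (.const 1))
        -- The body preserves the counter, so incrementing it yields the value `k + 1` that
        -- `loopIter` prescribes.
        simpa [NatExp.cost, loopIter, hg.nat_eq _ x x.lt_succ_self, loopIter_nat_self] using this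
  obtain ⟨t, ht, het⟩ := key (s.nat 0 + 1) 0 (by omega)
  refine ⟨2 + t, ?_, .seq (.setNat s x (.const 0)) het⟩
  simp only [Polynomial.eval_add, Polynomial.eval_mul, Polynomial.eval_X, Polynomial.eval_C,
    Polynomial.eval_one]
  omega

theorem loop_induction {n x : ℕ} {g : State → State} {s : State} (hn : s.nat 0 = n)
    (motive : ℕ → State → Prop) (zero : motive 0 (s.setNat x 0))
    (succ : ∀ k s', k ≤ n → s'.nat x = k → motive k s' → motive (k + 1) ((g s').setNat x (k + 1))) :
    motive (n + 1) (loop x g s) := by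
  have key : ∀ k ≤ n + 1, motive k (loopIter x g s k) := by
    intro k
    induction k with
    | zero => exact fun _ => zero
    | succ k ih =>
      exact fun hk => succ k _ (by omega) (loopIter_nat_self x g s k) (ih (by omega))
  rw [loop, hn]
  exact key _ le_rfl

/-- The nested loops `for x = 0, …, n` for the variables `x = l, …, l + r - 1`. -/
def nest (g : State → State) : ℕ → ℕ → State → State
  | _, 0 => g
  | l, r + 1 => loop l (nest g (l + 1) r)

theorem PolyTime.nest {r : ℕ} : ∀ {l : ℕ}, 0 < l → ∀ {g : State → State}, PolyTime (l + r) g →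
    PolyTime l (nest g l r) := by
  induction r with
  | zero => exact fun _ _ hg => hg
  | succ r ih => exact fun hl _ hg => .loop hl (ih (Nat.succ_pos _) (by rw [Nat.succ_add]; exact hg))

/-- Nested loops whose body preserves `Inv` and respects the preorder `Core` achieve everything
that the single executions of the body achieve, provided that it is stable under `Core`. -/
theorem nest_spec {n : ℕ} {g : State → State} {Core : State → State → Prop}
    {Q : (ℕ → ℕ) → State → Prop}
    (core_trans : ∀ {s₁ s₂ s₃}, Core s₁ s₂ → Core s₂ s₃ → Core s₁ s₃)
    (core_set : ∀ s x v, Core s (s.setNat x v))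
    (Q_mono : ∀ {v s s'}, Core s s' → Q v s → Q v s') {r : ℕ} :
    ∀ {l : ℕ}, 0 < l → PolyTime (l + r) g → ∀ {Inv : State → Prop},
      (∀ s x v, l ≤ x → x < l + r → Inv s → Inv (s.setNat x v)) →
      (∀ s, Inv s → s.nat 0 = n) →
      (∀ s, Inv s → (∀ i, l ≤ i → i < l + r → s.nat i ≤ n) →
        Inv (g s) ∧ Core s (g s) ∧ ∀ v, (∀ i < l + r, v i = s.nat i) → Q v (g s)) →
      ∀ s, Inv s → Inv (nest g l r s) ∧ Core s (nest g l r s) ∧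
        ∀ v, (∀ i < l, v i = s.nat i) → (∀ i, l ≤ i → i < l + r → v i ≤ n) →
          Q v (nest g l r s) := by
  induction r with
  | zero =>
    intro l _ _ Inv _ _ body s hs
    obtain ⟨h₁, h₂, h₃⟩ := body s hs (fun i _ _ => by omega)
    exact ⟨h₁, h₂, fun v hv _ => h₃ v hv⟩
  | succ r ih =>
    intro l hl hg Inv inv_set inv_n body s hs
    have hg' : PolyTime (l + 1 + r) g := by rwa [add_right_comm]
    -- The bound on the outer counter joins the invariant, since the innermost body needs bounds on
    -- all counters at once.
    have inner := ih (l := l + 1) (Nat.succ_pos _) hg' (Inv := fun s => Inv s ∧ s.nat l ≤ n)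
      (fun s x v hx hx' hs => ⟨inv_set s x v (by omega) (by omega) hs.1, by
        simpa [(show l ≠ x by omega)] using hs.2⟩) (fun s hs => inv_n s hs.1)
      (fun s hs hb => by
        obtain ⟨h₁, h₂, h₃⟩ := body s hs.1 (fun i hi hi' => by
          rcases hi.eq_or_lt with rfl | hi
          · exact hs.2
          · exact hb i hi (by omega))
        exact ⟨⟨h₁, by rw [hg.nat_eq s l (by omega)]; exact hs.2⟩, h₂,
          fun v hv => h₃ v (fun i hi => hv i (by omega))⟩)
    have hinner : PolyTime (l + 1) (RobustIntervalScheduling.nest g (l + 1) r) :=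
      PolyTime.nest (Nat.succ_pos _) hg'
    -- The counters are overwritten later, so achievements are indexed by a vector `v` of counter
    -- values. After `k` rounds those with `v l < k` are secured.
    have := loop_induction (x := l) (g := RobustIntervalScheduling.nest g (l + 1) r) (s := s)
      (inv_n s hs) (fun k s' => Inv s' ∧ Core s s' ∧ (∀ i < l, s'.nat i = s.nat i) ∧
        ∀ v, (∀ i < l, v i = s.nat i) → (∀ i, l ≤ i → i < l + (r + 1) → v i ≤ n) → v l < k →
          Q v s')
      ⟨inv_set s _ _ le_rfl (by omega) hs, core_set s _ _, fun i hi => by simp [hi.ne],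
        fun v _ _ h => absurd h (Nat.not_lt_zero _)⟩
      (fun k s' hk hs'k hs' => by
        obtain ⟨h₁, h₂, h₃, h₄⟩ := hs'
        obtain ⟨g₁, g₂, g₃⟩ := inner s' ⟨h₁, hs'k.trans_le hk⟩
        refine ⟨inv_set _ _ _ le_rfl (by omega) g₁.1, core_trans (core_trans h₂ g₂)
          (core_set _ _ _), fun i hi => ?_, fun v hv hv' hvk => ?_⟩
        · simp [hi.ne, hinner.nat_eq s' i (by omega), h₃ i hi]
        · refine Q_mono (core_set _ _ _) ?_
          rcases (Nat.lt_succ_iff.mp hvk).eq_or_lt with hvk | hvk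
          · refine g₃ v (fun i hi => ?_) (fun i hi hi' => hv' i (by omega) (by omega))
            rcases (Nat.lt_succ_iff.mp hi).eq_or_lt with rfl | hi
            · rw [hvk, hs'k]
            · rw [hv i hi, h₃ i hi]
          · exact Q_mono g₂ (h₄ v hv hv' hvk))
    exact ⟨this.1, this.2.1, fun v hv hv' => this.2.2.2 v hv hv'
      (Nat.lt_succ_of_le (hv' l le_rfl (by omega)))⟩

/-! ## Worst-case second-stage weights -/

section Robust

variable {E : Type} [DecidableEq E]

theorem mem_secondStage {S : Finset E} {f e : Option E} {x : E} :
    x ∈ secondStage S f e ↔ (x ∈ S ∧ f ≠ some x) ∨ e = some x := by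
  simp [secondStage, interdict]

/-- The weight of an element, or of nothing. -/
def optWeight (w : E → ℝ) (e : Option E) : ℝ := e.elim 0 w

theorem totalWeight_union_option (w : E → ℝ) {S : Finset E} {e : Option E}
    (he : ∀ x, e = some x → x ∉ S) :
    totalWeight w (S ∪ e.toFinset) = totalWeight w S + optWeight w e := by
  cases e with
  | none => simp [totalWeight, optWeight]
  | some x => simp [totalWeight, optWeight, Finset.sum_insert (he x rfl), add_comm]

theorem totalWeight_secondStage_of_notMem (w : E → ℝ) {S : Finset E} {f e : Option E}
    (hf : ∀ x, f = some x → x ∉ S) (he : ∀ x, e = some x → x ∉ S) :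
    totalWeight w (secondStage S f e) = totalWeight w S + optWeight w e := by
  have : interdict S f = S := by
    cases f with
    | none => simp [interdict]
    | some x => simp [interdict, hf x rfl]
  rw [secondStage, this, totalWeight_union_option w he]

theorem totalWeight_secondStage_of_mem (w : E → ℝ) {S : Finset E} {f : E} {e : Option E}
    (hf : f ∈ S) (he : ∀ x, e = some x → x ∉ S) :
    totalWeight w (secondStage S (some f) e) = totalWeight w S - w f + optWeight w e := by
  have h₁ : totalWeight w (interdict S (some f)) = totalWeight w S - w f := by
    rw [eq_sub_iff_add_eq]
    simp [interdict, totalWeight, Finset.sdiff_singleton_eq_erase, Finset.sum_erase_add S w hf]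
  rw [secondStage, totalWeight_union_option w, h₁]
  exact fun x hx hxS => he x hx (Finset.sdiff_subset hxS)

variable {F : Set (Finset E)} {w : E → ℝ} {S : Finset E}

theorem admissible_none (hF : IsLowerSet F) (hS : S ∈ F) (f : Option E) : Admissible F S f none :=
  ⟨by simp, hF (by simp [secondStage, interdict]) hS⟩

theorem exists_robustValue_eq [Finite E] (hF : IsLowerSet F) (hS : S ∈ F) :
    ∃ f e, Admissible F S f e ∧ robustValue F w S = totalWeight w (secondStage S f e) := by
  obtain ⟨f, hf⟩ := exists_eq_ciInf_of_finite
    (f := fun f : Option E => ⨆ e : {e : Option E // Admissible F S f e},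
      totalWeight w (secondStage S f e.1))
  have : Nonempty {e : Option E // Admissible F S f e} := ⟨none, admissible_none hF hS f⟩
  obtain ⟨e, he⟩ := exists_eq_ciSup_of_finite
    (f := fun e : {e : Option E // Admissible F S f e} => totalWeight w (secondStage S f e.1))
  exact ⟨f, e.1, e.2, by rw [robustValue, ← hf, ← he]⟩

/-- The form used throughout: a lower bound on the robust value is a choice of one answer per
deletion. -/
theorem le_robustValue_iff [Finite E] (hF : IsLowerSet F) (hS : S ∈ F) {c : ℝ} :
    c ≤ robustValue F w S ↔
      ∀ f, ∃ e, Admissible F S f e ∧ c ≤ totalWeight w (secondStage S f e) := by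
  rw [robustValue, le_ciInf_iff (Set.finite_range _).bddBelow]
  refine forall_congr' fun f => ⟨fun h => ?_, fun ⟨e, he, hc⟩ => ?_⟩
  · have : Nonempty {e : Option E // Admissible F S f e} := ⟨none, admissible_none hF hS f⟩
    obtain ⟨e, he⟩ := exists_eq_ciSup_of_finite
      (f := fun e : {e : Option E // Admissible F S f e} => totalWeight w (secondStage S f e.1))
    exact ⟨e.1, e.2, he ▸ h⟩
  · exact hc.trans (le_ciSup (f := fun e : {e : Option E // Admissible F S f e} =>
      totalWeight w (secondStage S f e.1)) (Set.finite_range _).bddAbove ⟨e, he⟩)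

end Robust

/-! ## Paths of jobs and replacements -/

/-- Jobs `0, …, n - 1` with non-empty intervals, and a job `n` that stands for no job. -/
structure Jobs (n : ℕ) where
  left : ℕ → ℕ
  right : ℕ → ℕ
  weight : ℕ → ℝ
  left_lt_right : ∀ j < n, left j < right j
  left_self : left n = 0
  right_self : right n = 0
  weight_self : weight n = 0
  weight_nonneg : ∀ j, 0 ≤ weight j

/-- A guess of the best two jobs `e₁`, `e₂` that can be added to a first-stage solution, and of its
worst-case loss, as a difference of the weights of `p` and `q`. -/
structure Guess where
  e₁ : ℕ
  e₂ : ℕ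
  p : ℕ
  q : ℕ

namespace Jobs

variable {n : ℕ} (J : Jobs n)

/-- Job `i` ends before job `j` begins. -/
def Prec (i j : ℕ) : Prop := J.right i ≤ J.left j

/-- The intervals of the jobs `i` and `j` are disjoint. -/
def Compat (i j : ℕ) : Prop := J.Prec i j ∨ J.Prec j i

/-- The feasible solutions. -/
def feasible : Set (Finset (Fin n)) := {S | ∀ i ∈ S, ∀ j ∈ S, i ≠ j → J.Compat i j}

/-- The weights of the jobs. -/
def weights (j : Fin n) : ℝ := J.weight j

/-- The job `e`, or nothing. -/
def opt (n e : ℕ) : Option (Fin n) := if h : e < n then some ⟨e, h⟩ else none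

/-- The guess passes the tests that do not involve the first-stage solution. -/
def Valid (θ : Guess) : Prop :=
  (θ.e₁ ≠ θ.e₂ ∨ ¬ θ.e₂ < n) ∧ J.weight θ.q ≤ J.weight θ.p + J.weight θ.e₁ ∧
    J.weight θ.q ≤ J.weight θ.p + J.weight θ.e₂

/-- The loss of `f` is affordable if it is compensated by `e₁` or by `e`. -/
def Affordable (θ : Guess) (f e : ℕ) : Prop :=
  J.weight f + J.weight θ.q ≤ J.weight θ.p + J.weight θ.e₁ ∨
    (e ≠ f ∧ J.weight f + J.weight θ.q ≤ J.weight θ.p + J.weight e)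

/-- Job `f`, with replacement `e`, may belong to a first-stage solution for the guess `θ`. -/
def Node (θ : Guess) (f e : ℕ) : Prop :=
  f < n ∧ J.Compat f θ.e₁ ∧ J.Compat f θ.e₂ ∧ J.Affordable θ f e

/-- Job `f` with replacement `e` may follow job `g` with replacement `h`. -/
def Edge (f e g h : ℕ) : Prop := J.Prec g f ∧ J.Prec h f ∧ J.Prec g e

/-- `S` is the set of the jobs on a path with `k` vertices that ends in job `f` with
replacement `e`; the path without vertices ends everywhere. -/
inductive Reach (θ : Guess) : ℕ → ℕ → ℕ → Finset (Fin n) → Prop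
  | zero (f e : ℕ) : Reach θ 0 f e ∅
  | succ {k g h : ℕ} {S : Finset (Fin n)} (f : Fin n) (e : ℕ) :
      g ≤ n → h ≤ n → e ≤ n → Reach θ k g h S → J.Node θ f e → J.Edge f e g h → Reach θ (k + 1) f e (insert f S)

/-! ### Soundness: a path certifies the guessed loss -/

variable {J} {θ : Guess}

theorem left_le_right {j : ℕ} (hj : j ≤ n) : J.left j ≤ J.right j := by
  rcases hj.eq_or_lt with rfl | hj
  · rw [J.left_self, J.right_self]
  · exact (J.left_lt_right j hj).le

theorem Compat.symm {i j : ℕ} (h : J.Compat i j) : J.Compat j i := Or.symm h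

theorem compat_none (i : ℕ) : J.Compat i n := Or.inr (by rw [Prec, J.right_self]; exact zero_le)

theorem not_prec_self (i : Fin n) : ¬ J.Prec i i := (J.left_lt_right i i.2).not_ge

theorem Prec.trans {i k : ℕ} {j : ℕ} (hj : j ≤ n) (h₁ : J.Prec i j) (h₂ : J.Prec j k) :
    J.Prec i k :=
  le_trans h₁ ((left_le_right hj).trans h₂)

theorem isLowerSet_feasible : IsLowerSet J.feasible :=
  fun _ _ hTS hS i hi j hj => hS i (hTS hi) j (hTS hj)

theorem empty_mem_feasible : ∅ ∈ J.feasible := by simp [feasible]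

theorem opt_eq_some {e : ℕ} {x : Fin n} : opt n e = some x ↔ e = x := by
  unfold opt
  split_ifs with h
  · simp [Fin.ext_iff]
  · simp only [false_iff]
    rintro rfl
    exact h x.2

theorem optWeight_opt {e : ℕ} (he : e ≤ n) : optWeight J.weights (opt n e) = J.weight e := by
  unfold opt
  split_ifs with h
  · rfl
  · rw [le_antisymm he (not_lt.mp h), J.weight_self]; rfl

theorem secondStage_opt_mem {S : Finset (Fin n)} (hS : S ∈ J.feasible) {f : Option (Fin n)} {e : ℕ}
    (he : ∀ z ∈ S, f ≠ some z → J.Compat z e) : secondStage S f (opt n e) ∈ J.feasible := by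
  intro i hi j hj hij
  rw [mem_secondStage, opt_eq_some] at hi hj
  rcases hi with ⟨hi, hi'⟩ | hi <;> rcases hj with ⟨hj, hj'⟩ | hj
  · exact hS i hi j hj hij
  · exact hj ▸ he i hi hi'
  · exact (hi ▸ he j hj hj').symm
  · exact absurd (Fin.ext (hi.symm.trans hj)) hij

/-- This is why a path may forget all but its last vertex: every earlier job lies to the left of
both the last job and its replacement. -/
theorem Reach.eq_or_prec {k f e : ℕ} {S : Finset (Fin n)} (h : J.Reach θ k f e S) :
    ∀ x ∈ S, (x : ℕ) = f ∨ (J.Prec x f ∧ J.Prec x e) := by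
  induction h with
  | zero => simp
  | @succ k g h S f e hg hh he hS hfe hE ih =>
    intro x hx
    rcases Finset.mem_insert.mp hx with rfl | hx
    · exact Or.inl rfl
    · right
      rcases ih x hx with h | h
      · exact h ▸ ⟨hE.1, hE.2.2⟩
      · exact ⟨h.1.trans hg hE.1, h.1.trans hg hE.2.2⟩

theorem Reach.prec_of_edge {k g h f e : ℕ} {S : Finset (Fin n)} (hg : g ≤ n)
    (hS : J.Reach θ k g h S) (hE : J.Edge f e g h) : ∀ x ∈ S, J.Prec x f ∧ J.Prec x e := by
  intro x hx
  rcases hS.eq_or_prec x hx with h | h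
  · exact h ▸ ⟨hE.1, hE.2.2⟩
  · exact ⟨h.1.trans hg hE.1, h.1.trans hg hE.2.2⟩

theorem Reach.notMem {k g h e : ℕ} {f : Fin n} {S : Finset (Fin n)} (hg : g ≤ n)
    (hS : J.Reach θ k g h S) (hE : J.Edge f e g h) : f ∉ S :=
  fun hf => not_prec_self f (hS.prec_of_edge hg hE f hf).1

theorem Reach.mem_feasible {k f e : ℕ} {S : Finset (Fin n)} (h : J.Reach θ k f e S) :
    S ∈ J.feasible := by
  induction h with
  | zero => exact empty_mem_feasible
  | @succ k g h S f e hg hh he hS hfe hE ih =>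
    have := hS.prec_of_edge hg hE
    intro i hi j hj hij
    rw [Finset.mem_insert] at hi hj
    rcases hi with rfl | hi
    · exact Or.inr (this j (hj.resolve_left hij.symm)).1
    · rcases hj with rfl | hj
      · exact Or.inl (this i hi).1
      · exact ih i hi j hj hij

theorem Reach.compat {k f e : ℕ} {S : Finset (Fin n)} (h : J.Reach θ k f e S) :
    ∀ x ∈ S, J.Compat x θ.e₁ ∧ J.Compat x θ.e₂ := by
  induction h with
  | zero => simp
  | @succ k g h S f e hg hh he hS hfe hE ih =>
    intro x hx
    rcases Finset.mem_insert.mp hx with rfl | hx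
    · exact ⟨hfe.2.1, hfe.2.2.1⟩
    · exact ih x hx

/-- The last alternative carries the induction. Once the path has moved on, an old replacement lies
to the left of the current job, hence of all later ones. -/
theorem Reach.exists_replacement {k f e : ℕ} {S : Finset (Fin n)} (h : J.Reach θ k f e S) :
    ∀ x ∈ S, ∃ y ≤ n, J.Affordable θ x y ∧ (∀ z ∈ S, z ≠ x → J.Compat z y) ∧
      ((x = f ∧ y = e) ∨ J.Prec y f) := by
  induction h with
  | zero => simp
  | @succ k g h S f e hg hh he hS hfe hE ih =>
    have hp := hS.prec_of_edge hg hE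
    intro x hx
    by_cases hxf : x = f
    · subst hxf
      refine ⟨e, he, hfe.2.2.2, fun z hz hzx => ?_, Or.inl ⟨rfl, rfl⟩⟩
      exact Or.inl (hp z (Finset.mem_of_mem_insert_of_ne hz hzx)).2
    · obtain ⟨y, hy, hay, hcy, h⟩ := ih x (Finset.mem_of_mem_insert_of_ne hx hxf)
      have hyf : J.Prec y f := by
        rcases h with ⟨-, rfl⟩ | h
        exacts [hE.2.1, h.trans hg hE.1]
      refine ⟨y, hy, hay, fun z hz hzx => ?_, Or.inr hyf⟩
      rcases Finset.mem_insert.mp hz with rfl | hz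
      exacts [Or.inr hyf, hcy z hz hzx]

/-- The sets of jobs on paths have the worst-case loss that was guessed, or a smaller one. -/
theorem Reach.le_robustValue {k f e : ℕ} {S : Finset (Fin n)} (h : J.Reach θ k f e S)
    (hθ : J.Valid θ) (h₁ : θ.e₁ ≤ n) (h₂ : θ.e₂ ≤ n) :
    totalWeight J.weights S - (J.weight θ.p - J.weight θ.q) ≤
      robustValue J.feasible J.weights S := by
  have hS := h.mem_feasible
  obtain ⟨hne, hq₁, hq₂⟩ := hθ
  -- Intervals are non-empty, so no job is compatible with itself; what is compatible with all of
  -- `S` is outside `S`.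
  have hmem : ∀ y : ℕ, (∀ x ∈ S, J.Compat x y) → ∀ x, opt n y = some x → x ∉ S := by
    intro y hy x hxy hx
    rw [opt_eq_some] at hxy
    subst hxy
    exact not_prec_self x (or_self_iff.mp (hy x hx))
  have hmem₁ := hmem θ.e₁ fun x hx => (h.compat x hx).1
  have hmem₂ := hmem θ.e₂ fun x hx => (h.compat x hx).2
  rw [le_robustValue_iff isLowerSet_feasible hS]
  intro o
  by_cases ho : ∃ x ∈ S, o = some x
  · obtain ⟨x, hx, rfl⟩ := ho
    obtain ⟨y, hy, hay, hcy, -⟩ := h.exists_replacement x hx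
    have hwx : J.weights x = J.weight x := rfl
    rcases hay with hay | ⟨hyx, hay⟩
    · refine ⟨opt n θ.e₁, ⟨fun z hz => ⟨hmem₁ z hz, ?_⟩,
        secondStage_opt_mem hS fun z hz _ => (h.compat z hz).1⟩, ?_⟩
      · rintro ⟨⟩
        exact hmem₁ x hz hx
      · rw [totalWeight_secondStage_of_mem _ hx hmem₁, optWeight_opt h₁]
        linarith
    -- The replacement is compatible with `S - x` and differs from `x`, hence it is outside `S`.
    · have hmemy : ∀ z, opt n y = some z → z ∉ S := by
        intro z hzy hz
        rw [opt_eq_some] at hzy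
        subst hzy
        exact not_prec_self z (or_self_iff.mp (hcy z hz (fun h => hyx (h ▸ rfl))))
      refine ⟨opt n y, ⟨fun z hz => ⟨hmemy z hz, ?_⟩,
        secondStage_opt_mem hS fun z hz hzx => hcy z hz (fun h => hzx (h ▸ rfl))⟩, ?_⟩
      · rintro ⟨⟩
        exact hmemy x hz hx
      · rw [totalWeight_secondStage_of_mem _ hx hmemy, optWeight_opt hy]
        linarith
  · have ho' : ∀ x, o = some x → x ∉ S := fun x hox hx => ho ⟨x, hx, hox⟩
    -- For a deletion outside `S`, answer with `e₂`, unless `e₂` itself is deleted; then `e₁` is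
    -- still available.
    by_cases h2 : ∃ x, opt n θ.e₂ = some x ∧ o = some x
    · obtain ⟨x, hx, rfl⟩ := h2
      rw [opt_eq_some] at hx
      refine ⟨opt n θ.e₁, ⟨fun z hz => ⟨hmem₁ z hz, ?_⟩,
        secondStage_opt_mem hS fun z hz _ => (h.compat z hz).1⟩, ?_⟩
      · rintro ⟨⟩
        rw [opt_eq_some] at hz
        exact hne.elim (fun h => h (hz.trans hx.symm)) (fun h => h (hx ▸ x.2))
      · rw [totalWeight_secondStage_of_notMem _ ho' hmem₁, optWeight_opt h₁]
        linarith
    · refine ⟨opt n θ.e₂, ⟨fun z hz => ⟨hmem₂ z hz, fun hoz => h2 ⟨z, hz, hoz⟩⟩,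
        secondStage_opt_mem hS fun z hz _ => (h.compat z hz).2⟩, ?_⟩
      rw [totalWeight_secondStage_of_notMem _ ho' hmem₂, optWeight_opt h₂]
      linarith

/-! ### Every feasible solution is found -/

/-- `e` can be added to `S`; so can `n`, which stands for no job. -/
def Addable (J : Jobs n) (S : Finset (Fin n)) (e : ℕ) : Prop := ∀ z ∈ S, J.Compat z e

theorem exists_opt_eq (o : Option (Fin n)) : ∃ e ≤ n, opt n e = o := by
  cases o with
  | none => exact ⟨n, le_rfl, by simp [opt]⟩
  | some x => exact ⟨x, x.2.le, opt_eq_some.mpr rfl⟩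

theorem compat_of_secondStage {S : Finset (Fin n)} {f : Option (Fin n)} {e : ℕ} (hen : e ≤ n)
    (he : ∀ x, opt n e = some x → x ∉ S) (h : secondStage S f (opt n e) ∈ J.feasible) :
    ∀ z ∈ S, f ≠ some z → J.Compat z e := by
  intro z hz hf
  rcases hen.eq_or_lt with rfl | hen
  · exact compat_none _
  · have heo : opt n e = some ⟨e, hen⟩ := opt_eq_some.mpr rfl
    refine h z (mem_secondStage.mpr (Or.inl ⟨hz, hf⟩)) ⟨e, hen⟩
      (mem_secondStage.mpr (Or.inr heo)) ?_
    rintro rfl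
    exact he _ heo hz

/-- Insert the jobs by increasing left end point. Feasibility makes the previous job precede the new
one, which gives the edge; the path has one vertex per job. -/
theorem exists_reach {S : Finset (Fin n)} (hS : S ∈ J.feasible) (φ : Fin n → ℕ)
    (hφ : ∀ f ∈ S, φ f ≤ n ∧ J.Node θ f (φ f))
    (hE : ∀ f ∈ S, ∀ g ∈ S, J.Prec g f → J.Edge f (φ f) g (φ g)) :
    ∃ k ≤ n, ∃ f ≤ n, ∃ e ≤ n, J.Reach θ k f e S := by
  have key : ∀ T : Finset (Fin n), T ⊆ S →
      ∃ f ≤ n, ∃ e ≤ n, J.Reach θ T.card f e T ∧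
        ((f = n ∧ e = n) ∨ ∃ x ∈ T, f = x ∧ e = φ x) := by
    intro T
    induction T using Finset.induction_on_max_value (fun x : Fin n => J.left x) with
    | empty => exact fun _ => ⟨n, le_rfl, n, le_rfl, .zero _ _, Or.inl ⟨rfl, rfl⟩⟩
    | insert a T haT hmax ih =>
      intro hT
      obtain ⟨haS, hTS⟩ := Finset.insert_subset_iff.mp hT
      obtain ⟨f, hf, e, he, hr, h⟩ := ih hTS
      refine ⟨a, a.2.le, φ a, (hφ a haS).1, ?_, Or.inr ⟨a, Finset.mem_insert_self _ _, rfl, rfl⟩⟩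
      rw [Finset.card_insert_of_notMem haT]
      refine .succ a (φ a) hf he (hφ a haS).1 hr (hφ a haS).2 ?_
      rcases h with ⟨rfl, rfl⟩ | ⟨x, hx, rfl, rfl⟩
      -- The path starts from the dummy pair `(n, n)`, whose right end points are `0`.
      · simp [Edge, Prec, J.right_self]
      · refine hE a haS x (hTS hx) ((hS x (hTS hx) a haS ?_).resolve_right fun h => ?_)
        -- In the remaining case `a` would end before `x` begins, although `a` has the largest left
        -- end point.
        · rintro rfl
          exact haT hx
        · exact (((J.left_lt_right a a.2).trans_le h).trans_le (hmax x hx)).false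
  obtain ⟨f, hf, e, he, hr, -⟩ := key S subset_rfl
  exact ⟨S.card, by simpa using S.card_le_univ, f, hf, e, he, hr⟩

/-- For every feasible solution, some guess is right, and the solution is on a path for it. -/
theorem exists_guess {S : Finset (Fin n)} (hS : S ∈ J.feasible) :
    ∃ θ : Guess, (θ.e₁ ≤ n ∧ θ.e₂ ≤ n ∧ θ.p ≤ n ∧ θ.q ≤ n) ∧ J.Valid θ ∧
      robustValue J.feasible J.weights S =
        totalWeight J.weights S - (J.weight θ.p - J.weight θ.q) ∧
      ∃ k ≤ n, ∃ f ≤ n, ∃ e ≤ n, J.Reach θ k f e S := by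
  classical
  -- the loss is a difference of two weights
  obtain ⟨p, hp, q, hq, hpq⟩ : ∃ p ≤ n, ∃ q ≤ n, robustValue J.feasible J.weights S =
      totalWeight J.weights S - (J.weight p - J.weight q) := by
    obtain ⟨f, o, ho, hv⟩ := exists_robustValue_eq (w := J.weights) isLowerSet_feasible hS
    obtain ⟨q, hq, rfl⟩ := exists_opt_eq o
    have hm := fun x hx => (ho.1 x hx).1
    by_cases hf : ∃ x ∈ S, f = some x
    · obtain ⟨x, hx, rfl⟩ := hf
      refine ⟨x, x.2.le, q, hq, ?_⟩
      rw [hv, totalWeight_secondStage_of_mem _ hx hm, optWeight_opt hq, weights]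
      ring
    · refine ⟨n, le_rfl, q, hq, ?_⟩
      rw [hv, totalWeight_secondStage_of_notMem _ (fun x hx hxS => hf ⟨x, hxS, hx⟩) hm,
        optWeight_opt hq, J.weight_self]
      ring
  have hcert := (le_robustValue_iff (w := J.weights) isLowerSet_feasible hS).mp hpq.ge
  have hcert' : ∀ f, ∃ e ≤ n, (∀ x, opt n e = some x → x ∉ S ∧ f ≠ some x) ∧
      (∀ z ∈ S, f ≠ some z → J.Compat z e) ∧
      totalWeight J.weights S - (J.weight p - J.weight q) ≤
        totalWeight J.weights (secondStage S f (opt n e)) := by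
    intro f
    obtain ⟨o, ho, hle⟩ := hcert f
    obtain ⟨e, he, rfl⟩ := exists_opt_eq o
    exact ⟨e, he, ho.1, compat_of_secondStage he (fun x hx => (ho.1 x hx).1) ho.2, hle⟩
  -- The answer to a deletion outside `S` can be added to all of `S`.
  have hadd : ∀ f, (∀ x, f = some x → x ∉ S) → ∃ e ≤ n, J.Addable S e ∧
      (∀ x, opt n e = some x → f ≠ some x) ∧ J.weight q ≤ J.weight p + J.weight e := by
    intro f hf
    obtain ⟨e, he, hm, hc, hle⟩ := hcert' f
    refine ⟨e, he, fun z hz => hc z hz fun h => hf z h hz, fun x hx => (hm x hx).2, ?_⟩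
    rw [totalWeight_secondStage_of_notMem _ hf (fun x hx => (hm x hx).1), optWeight_opt he] at hle
    linarith
  obtain ⟨e₁, he₁, hmax⟩ := Finset.exists_max_image
    ((Finset.range (n + 1)).filter fun e => J.Addable S e) J.weight
    ⟨n, by simpa using show J.Addable S n from fun z _ => compat_none _⟩
  simp only [Finset.mem_filter, Finset.mem_range, Nat.lt_succ_iff, and_imp] at he₁ hmax
  obtain ⟨he₁, ha₁⟩ := he₁
  have hq₁ : J.weight q ≤ J.weight p + J.weight e₁ := by
    obtain ⟨e, he, ha, -, hle⟩ := hadd none (by simp)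
    linarith [hmax e he ha]
  -- Take for `e₂` the answer to the deletion of `e₁`. If `e₁` is the dummy, there is nothing to
  -- delete and the dummy serves again.
  obtain ⟨e₂, he₂, ha₂, hne, hq₂⟩ : ∃ e₂ ≤ n, J.Addable S e₂ ∧ (e₁ ≠ e₂ ∨ ¬ e₂ < n) ∧
      J.weight q ≤ J.weight p + J.weight e₂ := by
    rcases he₁.eq_or_lt with rfl | hlt
    · exact ⟨_, le_rfl, ha₁, Or.inr (lt_irrefl _), hq₁⟩
    · obtain ⟨e, he, ha, hne, hle⟩ := hadd (some ⟨e₁, hlt⟩) (by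
        rintro x ⟨⟩ hx
        exact not_prec_self ⟨e₁, hlt⟩ (or_self_iff.mp (ha₁ _ hx)))
      refine ⟨e, he, ha, Or.inl ?_, hle⟩
      rintro rfl
      exact hne ⟨e₁, hlt⟩ (opt_eq_some.mpr rfl) rfl
  choose ε hεn hεm hεc hεw using fun f : Fin n => hcert' (some f)
  refine ⟨⟨e₁, e₂, p, q⟩, ⟨he₁, he₂, hp, hq⟩, ⟨hne, hq₁, hq₂⟩, hpq, ?_⟩
  -- The pair `(f, f)` encodes that `f` needs no replacement of its own: an answer compatible with
  -- `f` too can be added to `S`, so the heaviest such job `e₁` does as well.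
  refine exists_reach hS (fun f => if J.Compat f (ε f) then f else ε f) (fun f hf => ?_)
    (fun f hf g hg hgf => ?_)
  · have hw : J.weight f + J.weight q ≤ J.weight p + J.weight (ε f) := by
      have := hεw f
      rw [totalWeight_secondStage_of_mem _ hf fun x hx => (hεm f x hx).1,
        optWeight_opt (hεn f), weights] at this
      linarith
    refine ⟨by split_ifs; exacts [f.2.le, hεn f], f.2, ha₁ f hf, ha₂ f hf, ?_⟩
    split_ifs with hc
    · refine Or.inl (hw.trans (add_le_add_right (hmax _ (hεn f) fun z hz => ?_) _))
      by_cases hzf : f = z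
      exacts [hzf ▸ hc, hεc f z hz (by simpa using hzf)]
    · exact Or.inr ⟨fun h => (hεm f f (opt_eq_some.mpr h)).1 hf, hw⟩
  · have hfg : f ≠ g := by
      rintro rfl
      exact not_prec_self f hgf
    refine ⟨hgf, ?_, ?_⟩ <;> split_ifs with hc
    · exact hgf
    -- If `ε g` began after `f` ended, it would be compatible with `g`, contrary to the case at
    -- hand. The other side is symmetric.
    · exact ((hεc g f hf (by simpa using hfg.symm)).resolve_left
        fun h => hc (Or.inl (hgf.trans f.2.le h)))
    · exact hgf
    · exact ((hεc f g hg (by simpa using hfg)).resolve_right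
        fun h => hc (Or.inr (Prec.trans g.2.le h hgf)))

end Jobs

namespace Jobs

variable {n : ℕ} (J : Jobs n)

/-! ## The dynamic program

Besides the input, the memory holds the powers of two (array `3`), the multiples of `n + 1`
(array `4`), for every pair `(f, e)` the weight (real array `1`) and the bit mask (array `5`) of
the best path found that ends in `(f, e)`, and the best value (real variable `0`) and its bit mask
(array `6`, entry `0`). The variables `1`, …, `4` hold the guess, `5` counts the rounds, and `6`,
…, `9` hold two vertices `(f, e)` and `(g, h)`. -/

/-- The memory holds the jobs and the auxiliary tables. -/
structure Holds (s : State) : Prop where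
  nat_zero : s.nat 0 = n
  left : s.natArr 0 = J.left
  right : s.natArr 1 = J.right
  weight : s.realArr 0 = J.weight
  pow : ∀ i ≤ n, s.natArr 3 i = 2 ^ i
  mul : ∀ i ≤ n, s.natArr 4 i = i * (n + 1)

/-- The memory holds the jobs, the auxiliary tables and the guess `θ`. -/
structure HoldsGuess (θ : Guess) (s : State) : Prop extends J.Holds s where
  nat_one : s.nat 1 = θ.e₁
  nat_two : s.nat 2 = θ.e₂
  nat_three : s.nat 3 = θ.p
  nat_four : s.nat 4 = θ.q

/-- The bit mask of a set of jobs. -/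
def mask (S : Finset (Fin n)) : ℕ := ∑ j ∈ S, 2 ^ (j : ℕ)

/-- The index of the pair `(f, e)`. -/
def idx (n f e : ℕ) : ℕ := f * (n + 1) + e

/-- The tables of the dynamic program describe paths. -/
def Sound (θ : Guess) (s : State) : Prop :=
  ∀ f ≤ n, ∀ e ≤ n, ∃ k S, J.Reach θ k f e S ∧
    s.realArr 1 (idx n f e) = totalWeight J.weights S ∧ s.natArr 5 (idx n f e) = mask S

/-- The tables of the dynamic program dominate all paths with at most `k` vertices. -/
def Done (θ : Guess) (k : ℕ) (s : State) : Prop :=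
  ∀ j ≤ k, ∀ f ≤ n, ∀ e ≤ n, ∀ S, J.Reach θ j f e S →
    totalWeight J.weights S ≤ s.realArr 1 (idx n f e)

/-- The best value found is not larger than the value of the recorded feasible solution. -/
def BestSound (s : State) : Prop :=
  ∃ S ∈ J.feasible, s.natArr 6 0 = mask S ∧ s.real 0 ≤ robustValue J.feasible J.weights S

variable {J} {θ : Guess} {s : State}

theorem idx_inj {f e g h : ℕ} (he : e ≤ n) (hh : h ≤ n) :
    idx n f e = idx n g h ↔ f = g ∧ e = h := by
  refine ⟨fun H => ?_, fun ⟨h₁, h₂⟩ => h₁ ▸ h₂ ▸ rfl⟩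
  have h₁ : f = g := by
    have := congrArg (· / (n + 1)) H
    simpa [idx, Nat.add_div_of_dvd_right (Dvd.intro_left _ rfl), Nat.div_eq_of_lt,
      Nat.lt_succ_of_le he, Nat.lt_succ_of_le hh, Nat.mul_div_cancel] using this
  subst h₁
  exact ⟨rfl, by simpa [idx] using H⟩

theorem Holds.setNat (h : J.Holds s) {x : ℕ} (hx : 0 < x) (v : ℕ) : J.Holds (s.setNat x v) :=
  ⟨by simp [hx.ne, h.nat_zero], h.left, h.right, h.weight, h.pow, h.mul⟩

theorem Holds.putNat (h : J.Holds s) {a : ℕ} (ha : a = 2 ∨ 4 < a) (i v : ℕ) :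
    J.Holds (s.putNat a i v) := by
  constructor
  · exact h.nat_zero
  · rw [State.putNat_natArr, if_neg (by omega), h.left]
  · rw [State.putNat_natArr, if_neg (by omega), h.right]
  · exact h.weight
  · rw [State.putNat_natArr, if_neg (by omega)]; exact h.pow
  · rw [State.putNat_natArr, if_neg (by omega)]; exact h.mul

theorem Holds.putReal (h : J.Holds s) (i : ℕ) (v : ℝ) : J.Holds (s.putReal 1 i v) :=
  ⟨h.nat_zero, h.left, h.right, by simp [h.weight], h.pow, h.mul⟩

theorem Holds.setReal (h : J.Holds s) (x : ℕ) (v : ℝ) : J.Holds (s.setReal x v) :=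
  ⟨h.nat_zero, h.left, h.right, h.weight, h.pow, h.mul⟩

theorem HoldsGuess.setNat (h : J.HoldsGuess θ s) {x : ℕ} (hx : 4 < x) (v : ℕ) :
    J.HoldsGuess θ (s.setNat x v) :=
  ⟨h.toHolds.setNat (by omega) v, by simp [show 1 ≠ x by omega, h.nat_one],
    by simp [show 2 ≠ x by omega, h.nat_two], by simp [show 3 ≠ x by omega, h.nat_three],
    by simp [show 4 ≠ x by omega, h.nat_four]⟩

theorem HoldsGuess.of_holds (h : J.HoldsGuess θ s) {s' : State} (h' : J.Holds s')
    (hs : s'.nat = s.nat) : J.HoldsGuess θ s' :=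
  ⟨h', by rw [hs, h.nat_one], by rw [hs, h.nat_two], by rw [hs, h.nat_three],
    by rw [hs, h.nat_four]⟩

/-! ### Expressions and tests -/

/-- Disjunction of tests. -/
def orTest (b c : Test) : Test := .not (.and (.not b) (.not c))

/-- The test `e₁ ≤ e₂`. -/
def leTest (e₁ e₂ : RealExp) : Test := .not (.realLt e₂ e₁)

/-- The test `e₁ ≠ e₂`. -/
def neTest (e₁ e₂ : NatExp) : Test := orTest (.natLt e₁ e₂) (.natLt e₂ e₁)

/-- The test for `Prec`, of the jobs in two variables. -/
def precTest (x y : ℕ) : Test := .not (.natLt (.get 0 (.var y)) (.get 1 (.var x)))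

/-- The weight of the job in a variable. -/
def weightExp (x : ℕ) : RealExp := .get 0 (.var x)

/-- The index of the pair of the values of two variables. -/
def idxExp (x y : ℕ) : NatExp := .add (.get 4 (.var x)) (.var y)

/-- The test for `Valid`. -/
def validTest : Test :=
  .and (orTest (neTest (.var 1) (.var 2)) (.not (.natLt (.var 2) (.var 0))))
    (.and (leTest (weightExp 4) (.add (weightExp 3) (weightExp 1)))
      (leTest (weightExp 4) (.add (weightExp 3) (weightExp 2))))

/-- The test for `Node`. -/
def nodeTest : Test :=
  .and (.natLt (.var 6) (.var 0))
    (.and (orTest (precTest 6 1) (precTest 1 6))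
      (.and (orTest (precTest 6 2) (precTest 2 6))
        (orTest (leTest (.add (weightExp 6) (weightExp 4)) (.add (weightExp 3) (weightExp 1)))
          (.and (neTest (.var 7) (.var 6))
            (leTest (.add (weightExp 6) (weightExp 4)) (.add (weightExp 3) (weightExp 7)))))))

/-- The test for `Edge`. -/
def edgeTest : Test := .and (precTest 8 6) (.and (precTest 9 6) (precTest 8 7))

@[simp] theorem orTest_holds {b c : Test} : (orTest b c).Holds s ↔ b.Holds s ∨ c.Holds s := by
  simp only [orTest, Test.Holds]; tauto

@[simp] theorem leTest_holds {e₁ e₂ : RealExp} :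
    (leTest e₁ e₂).Holds s ↔ e₁.eval s ≤ e₂.eval s := by
  simp [leTest]

@[simp] theorem neTest_holds {e₁ e₂ : NatExp} :
    (neTest e₁ e₂).Holds s ↔ e₁.eval s ≠ e₂.eval s := by
  simp [neTest]

theorem Holds.precTest_holds (h : J.Holds s) (x y : ℕ) :
    (precTest x y).Holds s ↔ J.Prec (s.nat x) (s.nat y) := by
  simp [precTest, Prec, h.left, h.right]

theorem Holds.weightExp_eval (h : J.Holds s) (x : ℕ) :
    (weightExp x).eval s = J.weight (s.nat x) := by
  simp [weightExp, h.weight]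

theorem Holds.idxExp_eval (h : J.Holds s) {x : ℕ} (hx : s.nat x ≤ n) (y : ℕ) :
    (idxExp x y).eval s = idx n (s.nat x) (s.nat y) := by
  simp [idxExp, idx, h.mul _ hx]

theorem HoldsGuess.validTest_holds (h : J.HoldsGuess θ s) :
    validTest.Holds s ↔ J.Valid θ := by
  simp [validTest, Valid, h.weightExp_eval, h.nat_zero, h.nat_one, h.nat_two, h.nat_three,
    h.nat_four]

theorem HoldsGuess.nodeTest_holds (h : J.HoldsGuess θ s) :
    nodeTest.Holds s ↔ J.Node θ (s.nat 6) (s.nat 7) := by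
  simp [nodeTest, Node, Compat, Affordable, h.weightExp_eval, h.precTest_holds, h.nat_zero,
    h.nat_one, h.nat_two, h.nat_three, h.nat_four]

theorem Holds.edgeTest_holds (h : J.Holds s) :
    edgeTest.Holds s ↔ J.Edge (s.nat 6) (s.nat 7) (s.nat 8) (s.nat 9) := by
  simp [edgeTest, Edge, h.precTest_holds]

/-! ### Initialization of the tables -/

/-- Record the path without vertices. -/
def clear (s : State) : State :=
  (fun s => s.putNat 5 ((idxExp 6 7).eval s) ((NatExp.const 0).eval s))
    (s.putReal 1 ((idxExp 6 7).eval s) (RealExp.zero.eval s))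

theorem polyTime_clear {l : ℕ} (hl : 0 < l) : PolyTime l clear :=
  .comp hl (.putNat 5 _ _) (.putReal 1 _ _)

/-- Two memories have the same best value. -/
def SameBest (s s' : State) : Prop := s'.real 0 = s.real 0 ∧ s'.natArr 6 = s.natArr 6

/-- All-zero tables are correct at the start because the empty path ends at every pair. -/
theorem nest_clear (hs : J.HoldsGuess θ s) :
    J.HoldsGuess θ (nest clear 6 2 s) ∧ SameBest s (nest clear 6 2 s) ∧
      J.Sound θ (nest clear 6 2 s) ∧ J.Done θ 0 (nest clear 6 2 s) := by
  have := nest_spec (n := n) (g := clear) (r := 2) (l := 6)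
    -- Only that cleared entries stay cleared has to persist between the rounds.
    (Core := fun s s' => ∀ i, s.realArr 1 i = 0 ∧ s.natArr 5 i = 0 →
      s'.realArr 1 i = 0 ∧ s'.natArr 5 i = 0)
    (Q := fun v s => s.realArr 1 (idx n (v 6) (v 7)) = 0 ∧ s.natArr 5 (idx n (v 6) (v 7)) = 0)
    (fun h₁ h₂ i hi => h₂ i (h₁ i hi)) (fun s x v i hi => hi) (fun h hQ => h _ hQ)
    (by omega) (polyTime_clear (by omega)) (Inv := fun s' => J.HoldsGuess θ s' ∧ SameBest s s')
    (fun s x v hx hx' hs => ⟨hs.1.setNat (by omega) v, hs.2⟩) (fun s hs => hs.1.nat_zero)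
    (fun s₁ hs₁ hb => by
      have hc : clear s₁ = (s₁.putReal 1 (idx n (s₁.nat 6) (s₁.nat 7)) 0).putNat 5
          (idx n (s₁.nat 6) (s₁.nat 7)) 0 := by
        have h6 := hb 6 (by omega) (by omega)
        have := fun i v => (hs₁.1.putReal i v).idxExp_eval h6 7
        simp [clear, this, hs₁.1.idxExp_eval h6]
      rw [hc]
      refine ⟨⟨hs₁.1.of_holds ((hs₁.1.putReal _ _).putNat (by omega) _ _) rfl, ?_⟩, ?_, ?_⟩
      · simpa [SameBest] using hs₁.2
      · intro i hi
        simp [Function.update_apply, hi.1, hi.2]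
      · intro v hv
        simp [hv 6 (by omega), hv 7 (by omega)])
    s ⟨hs, rfl, rfl⟩
  obtain ⟨⟨h₁, h₂⟩, -, h₃⟩ := this
  have h₄ : ∀ f ≤ n, ∀ e ≤ n, (nest clear 6 2 s).realArr 1 (idx n f e) = 0 ∧
      (nest clear 6 2 s).natArr 5 (idx n f e) = 0 := by
    intro f hf e he
    refine h₃ (fun i => if i = 6 then f else if i = 7 then e else s.nat i)
      (fun i hi => by simp [show i ≠ 6 by omega, show i ≠ 7 by omega]) (fun i hi hi' => ?_)
    obtain rfl | rfl : i = 6 ∨ i = 7 := by omega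
    · exact hf
    · exact he
  refine ⟨h₁, h₂, fun f hf e he => ⟨0, ∅, .zero f e, ?_⟩, fun j hj f hf e he S hS => ?_⟩
  · simpa [totalWeight, mask] using h₄ f hf e he
  · rw [Nat.le_zero.mp hj] at hS
    cases hS
    simp [totalWeight, (h₄ f hf e he).1]

/-! ### Rounds of relaxations -/

/-- The test whether the path to `(g, h)` can be extended to a better path to `(f, e)`. -/
def relaxTest : Test :=
  .and nodeTest (.and edgeTest
    (.realLt (.get 1 (idxExp 6 7)) (.add (.get 1 (idxExp 8 9)) (weightExp 6))))

open Classical in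
/-- Extend the path to `(g, h)` to a path to `(f, e)`, if this is an improvement. -/
def relax (s : State) : State :=
  if relaxTest.Holds s then
    ((fun s => s.putReal 1 ((idxExp 6 7).eval s)
        ((RealExp.add (.get 1 (idxExp 8 9)) (weightExp 6)).eval s)) ∘
      fun s => s.putNat 5 ((idxExp 6 7).eval s)
        ((NatExp.add (.get 5 (idxExp 8 9)) (.get 3 (.var 6))).eval s)) s
  else s

theorem polyTime_relax {l : ℕ} (hl : 0 < l) : PolyTime l relax :=
  .ite relaxTest (.comp hl (.putReal 1 _ _) (.putNat 5 _ _)) .skip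

/-- Updating in place is harmless: `Sound` allows paths of any length, so a source entry that was
already improved in this round still describes a path, and entries never decrease. -/
theorem relax_spec {k : ℕ} (hs : J.HoldsGuess θ s) (hS : J.Sound θ s) (hD : J.Done θ k s)
    (hb : ∀ i, 6 ≤ i → i < 10 → s.nat i ≤ n) :
    (J.HoldsGuess θ (relax s) ∧ SameBest s (relax s) ∧ J.Sound θ (relax s)) ∧
      (∀ i, s.realArr 1 i ≤ (relax s).realArr 1 i) ∧
      ∀ S, J.Reach θ k (s.nat 8) (s.nat 9) S → J.Node θ (s.nat 6) (s.nat 7) →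
        J.Edge (s.nat 6) (s.nat 7) (s.nat 8) (s.nat 9) →
          totalWeight J.weights S + J.weight (s.nat 6) ≤
            (relax s).realArr 1 (idx n (s.nat 6) (s.nat 7)) := by
  have h6 := hb 6 (by omega) (by omega)
  have h7 := hb 7 (by omega) (by omega)
  have h8 := hb 8 (by omega) (by omega)
  have h9 := hb 9 (by omega) (by omega)
  have hiff : relaxTest.Holds s ↔ J.Node θ (s.nat 6) (s.nat 7) ∧
      J.Edge (s.nat 6) (s.nat 7) (s.nat 8) (s.nat 9) ∧
      s.realArr 1 (idx n (s.nat 6) (s.nat 7)) <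
        s.realArr 1 (idx n (s.nat 8) (s.nat 9)) + J.weight (s.nat 6) := by
    simp [relaxTest, hs.nodeTest_holds, hs.edgeTest_holds, hs.idxExp_eval h6, hs.idxExp_eval h8,
      hs.weightExp_eval]
  by_cases hR : relaxTest.Holds s
  · obtain ⟨hN, hE, hlt⟩ := hiff.mp hR
    have hc : relax s = (s.putNat 5 (idx n (s.nat 6) (s.nat 7))
          (s.natArr 5 (idx n (s.nat 8) (s.nat 9)) + 2 ^ s.nat 6)).putReal 1
        (idx n (s.nat 6) (s.nat 7))
        (s.realArr 1 (idx n (s.nat 8) (s.nat 9)) + J.weight (s.nat 6)) := by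
      rw [relax, if_pos hR]
      have := fun v => (hs.toHolds.putNat (a := 5) (by omega) (idx n (s.nat 6) (s.nat 7)) v)
      simp [hs.idxExp_eval h6, hs.idxExp_eval h8, (this _).idxExp_eval h6,
        (this _).idxExp_eval h8, (this _).weightExp_eval, hs.pow _ h6]
    have hmono : ∀ i, s.realArr 1 i ≤ (relax s).realArr 1 i := by
      intro i
      simp only [hc, State.putReal_realArr, State.putNat_realArr, if_true, Function.update_apply]
      split_ifs with hi
      · exact hi ▸ hlt.le
      · exact le_rfl
    refine ⟨⟨?_, ?_, ?_⟩, hmono, ?_⟩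
    · rw [hc]
      exact hs.of_holds ((hs.toHolds.putNat (by omega) _ _).putReal _ _) rfl
    · simp [hc, SameBest]
    · intro f hf e he
      by_cases hfe : f = s.nat 6 ∧ e = s.nat 7
      · obtain ⟨k, S, hr, hd, hm⟩ := hS (s.nat 8) h8 (s.nat 9) h9
        -- As the new job is not yet on the path, adding its weight and its power of two is exact.
        have hnot := hr.notMem (f := ⟨s.nat 6, hN.1⟩) h8 hE
        refine ⟨k + 1, insert ⟨s.nat 6, hN.1⟩ S, ?_, ?_, ?_⟩
        · rw [hfe.1, hfe.2]
          exact .succ ⟨s.nat 6, hN.1⟩ _ h8 h9 h7 hr hN hE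
        · rw [totalWeight, Finset.sum_insert hnot]
          simp [hc, hfe.1, hfe.2, hd, totalWeight, weights, add_comm]
        · rw [mask, Finset.sum_insert hnot]
          simp [hc, hfe.1, hfe.2, hm, mask, add_comm]
      · have : idx n f e ≠ idx n (s.nat 6) (s.nat 7) := fun h => hfe ((idx_inj he h7).mp h)
        simpa [hc, this] using hS f hf e he
    · intro S hr _ _
      simpa [hc] using hD k le_rfl _ h8 _ h9 S hr
  · have hc : relax s = s := by rw [relax, if_neg hR]
    rw [hc]
    refine ⟨⟨hs, ⟨rfl, rfl⟩, hS⟩, fun _ => le_rfl, fun S hr hN hE => ?_⟩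
    have := hD k le_rfl _ h8 _ h9 S hr
    have : ¬ _ := fun h => hR (hiff.mpr ⟨hN, hE, h⟩)
    linarith

/-- A path with `k + 1` vertices is a path with `k` vertices and a last edge, and each round tries
every edge. -/
theorem nest_relax {k : ℕ} (hs : J.HoldsGuess θ s) (hS : J.Sound θ s) (hD : J.Done θ k s) :
    J.HoldsGuess θ (nest relax 6 4 s) ∧ SameBest s (nest relax 6 4 s) ∧
      J.Sound θ (nest relax 6 4 s) ∧ J.Done θ (k + 1) (nest relax 6 4 s) := by
  have := nest_spec (n := n) (g := relax) (r := 4) (l := 6)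
    (Core := fun s s' => ∀ i, s.realArr 1 i ≤ s'.realArr 1 i)
    (Q := fun v s => ∀ S, J.Reach θ k (v 8) (v 9) S → J.Node θ (v 6) (v 7) →
        J.Edge (v 6) (v 7) (v 8) (v 9) →
          totalWeight J.weights S + J.weight (v 6) ≤ s.realArr 1 (idx n (v 6) (v 7)))
    (fun h₁ h₂ i => (h₁ i).trans (h₂ i)) (fun s x v i => le_rfl)
    (fun h hQ S h₁ h₂ h₃ => (hQ S h₁ h₂ h₃).trans (h _))
    (by omega) (polyTime_relax (by omega))
    (Inv := fun s' => J.HoldsGuess θ s' ∧ SameBest s s' ∧ J.Sound θ s' ∧ J.Done θ k s')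
    (fun s x v hx hx' hs => ⟨hs.1.setNat (by omega) v, hs.2⟩) (fun s hs => hs.1.nat_zero)
    (fun s₁ hs₁ hb => by
      obtain ⟨⟨h₁, h₂, h₃⟩, h₄, h₅⟩ := relax_spec hs₁.1 hs₁.2.2.1 hs₁.2.2.2 hb
      refine ⟨⟨h₁, ⟨h₂.1.trans hs₁.2.1.1, h₂.2.trans hs₁.2.1.2⟩, h₃,
        fun j hj f hf e he S hS => (hs₁.2.2.2 j hj f hf e he S hS).trans (h₄ _)⟩, h₄, ?_⟩
      intro v hv
      rw [hv 6 (by omega), hv 7 (by omega), hv 8 (by omega), hv 9 (by omega)]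
      exact h₅)
    s ⟨hs, ⟨rfl, rfl⟩, hS, hD⟩
  obtain ⟨⟨h₁, h₂, h₃, h₄⟩, -, h₅⟩ := this
  refine ⟨h₁, h₂, h₃, fun j hj f hf e he S hr => ?_⟩
  rcases hj.eq_or_lt with rfl | hj
  · rcases hr with _ | ⟨f, e, hg, hh, -, hr, hN, hE⟩
    rename_i g h S
    rw [totalWeight, Finset.sum_insert (hr.notMem hg hE), add_comm]
    refine h₅ (fun i => if i = 6 then f else if i = 7 then e else if i = 8 then g else
      if i = 9 then h else s.nat i) (fun i hi => ?_) (fun i hi hi' => ?_) S hr hN hE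
    · simp [show i ≠ 6 by omega, show i ≠ 7 by omega, show i ≠ 8 by omega, show i ≠ 9 by omega]
    · obtain rfl | rfl | rfl | rfl : i = 6 ∨ i = 7 ∨ i = 8 ∨ i = 9 := by omega
      exacts [hf, he, hg, hh]
  · exact h₄ j (by omega) f hf e he S hr

/-- The loop runs over `0, …, n`, hence `n + 1` rounds; `exists_guess` asks only for paths with at
most `n` vertices. -/
theorem loop_nest_relax (hs : J.HoldsGuess θ s) (hS : J.Sound θ s) (hD : J.Done θ 0 s) :
    J.HoldsGuess θ (loop 5 (nest relax 6 4) s) ∧ SameBest s (loop 5 (nest relax 6 4) s) ∧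
      J.Sound θ (loop 5 (nest relax 6 4) s) ∧ J.Done θ (n + 1) (loop 5 (nest relax 6 4) s) :=
  loop_induction hs.nat_zero
    (fun k s' => J.HoldsGuess θ s' ∧ SameBest s s' ∧ J.Sound θ s' ∧ J.Done θ k s')
    ⟨hs.setNat (by omega) _, ⟨rfl, rfl⟩, hS, hD⟩ fun k s' _ _ hs' => by
      obtain ⟨h₁, h₂, h₃, h₄⟩ := nest_relax hs'.1 hs'.2.2.1 hs'.2.2.2
      exact ⟨h₁.setNat (by omega) _, ⟨h₂.1.trans hs'.2.1.1, h₂.2.trans hs'.2.1.2⟩, h₃, h₄⟩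

/-! ### Recording the best solution -/

/-- The guaranteed value of the path to `(f, e)`. -/
def valueExp : RealExp := .sub (.get 1 (idxExp 6 7)) (.sub (weightExp 3) (weightExp 4))

open Classical in
/-- Record the path to `(f, e)` if it is better than the best solution so far. -/
def record (s : State) : State :=
  if (Test.realLt (.var 0) valueExp).Holds s then
    ((fun s => s.putNat 6 ((NatExp.const 0).eval s) ((NatExp.get 5 (idxExp 6 7)).eval s)) ∘
      fun s => s.setReal 0 (valueExp.eval s)) s
  else s

theorem polyTime_record {l : ℕ} (hl : 0 < l) : PolyTime l record :=
  .ite _ (.comp hl (.putNat 6 _ _) (.setReal 0 _)) .skip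

/-- The recorded value is path weight minus guessed loss. It never exceeds the robust value of the
recorded set, by `Reach.le_robustValue`, and it dominates this quantity for every path. -/
theorem nest_record (hs : J.HoldsGuess θ s) (hS : J.Sound θ s) (hD : J.Done θ n s)
    (hB : J.BestSound s) (hθ : J.Valid θ) (h₁ : θ.e₁ ≤ n) (h₂ : θ.e₂ ≤ n) :
    J.Holds (nest record 6 2 s) ∧ J.BestSound (nest record 6 2 s) ∧
      s.real 0 ≤ (nest record 6 2 s).real 0 ∧
      ∀ k ≤ n, ∀ f ≤ n, ∀ e ≤ n, ∀ S, J.Reach θ k f e S →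
        totalWeight J.weights S - (J.weight θ.p - J.weight θ.q) ≤
          (nest record 6 2 s).real 0 := by
  have := nest_spec (n := n) (g := record) (r := 2) (l := 6)
    (Core := fun s s' => s.real 0 ≤ s'.real 0 ∧ s'.realArr 1 = s.realArr 1)
    (Q := fun v s => s.realArr 1 (idx n (v 6) (v 7)) - (J.weight θ.p - J.weight θ.q) ≤ s.real 0)
    (fun h₁ h₂ => ⟨h₁.1.trans h₂.1, h₂.2.trans h₁.2⟩) (fun s x v => ⟨le_rfl, rfl⟩)
    (fun h hQ => by rw [h.2]; exact hQ.trans h.1)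
    (by omega) (polyTime_record (by omega))
    (Inv := fun s' => J.HoldsGuess θ s' ∧ J.Sound θ s' ∧ J.BestSound s')
    (fun s x v hx hx' hs => ⟨hs.1.setNat (by omega) v, hs.2⟩) (fun s hs => hs.1.nat_zero)
    (fun s₁ ⟨hs₁, hS₁, hB₁⟩ hb => by
      have h6 := hb 6 (by omega) (by omega)
      have h7 := hb 7 (by omega) (by omega)
      have hv : valueExp.eval s₁ = s₁.realArr 1 (idx n (s₁.nat 6) (s₁.nat 7)) -
          (J.weight θ.p - J.weight θ.q) := by
        simp [valueExp, hs₁.idxExp_eval h6, hs₁.weightExp_eval, hs₁.nat_three, hs₁.nat_four]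
      by_cases hR : (Test.realLt (.var 0) valueExp).Holds s₁
      · have hc : record s₁ = (s₁.setReal 0 (valueExp.eval s₁)).putNat 6 0
            (s₁.natArr 5 (idx n (s₁.nat 6) (s₁.nat 7))) := by
          rw [record, if_pos hR]
          simp [(hs₁.toHolds.setReal 0 (valueExp.eval s₁)).idxExp_eval h6]
        rw [hc]
        refine ⟨⟨hs₁.of_holds ((hs₁.toHolds.setReal _ _).putNat (by omega) _ _) rfl,
          by simpa [Sound] using hS₁, ?_⟩, ⟨?_, rfl⟩, fun v hv' => ?_⟩
        · obtain ⟨k, S, hr, hd, hm⟩ := hS₁ _ h6 _ h7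
          refine ⟨S, hr.mem_feasible, by simp [hm], ?_⟩
          simpa [hv, hd] using hr.le_robustValue hθ h₁ h₂
        · simpa using (show s₁.real 0 < valueExp.eval s₁ from hR).le
        · simp [hv, hv' 6 (by omega), hv' 7 (by omega)]
      · rw [record, if_neg hR]
        refine ⟨⟨hs₁, hS₁, hB₁⟩, ⟨le_rfl, rfl⟩, fun v hv' => ?_⟩
        rw [hv' 6 (by omega), hv' 7 (by omega), ← hv]
        exact not_lt.mp hR)
    s ⟨hs, hS, hB⟩
  obtain ⟨⟨g₁, -, g₂⟩, ⟨g₃, g₄⟩, g₅⟩ := this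
  refine ⟨g₁.toHolds, g₂, g₃, fun k hk f hf e he S hr => ?_⟩
  have := g₅ (fun i => if i = 6 then f else if i = 7 then e else s.nat i)
    (fun i hi => by simp [show i ≠ 6 by omega, show i ≠ 7 by omega]) (fun i hi hi' => by
      obtain rfl | rfl : i = 6 ∨ i = 7 := by omega
      exacts [hf, he])
  refine le_trans (sub_le_sub_right ?_ _) this
  rw [g₄]
  exact hD k hk f hf e he S hr

/-! ### All guesses -/

open Classical in
/-- Find the best solution for the guess in the variables `1`, …, `4`. -/
def tryGuess (s : State) : State :=
  if validTest.Holds s then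
    (nest record 6 2 ∘ loop 5 (nest relax 6 4) ∘ nest clear 6 2) s
  else s

theorem polyTime_tryGuess : PolyTime 5 tryGuess :=
  .ite _ (.comp (by omega) ((PolyTime.nest (by omega) (polyTime_record (by omega))).of_le (by omega))
    (.comp (by omega) (.loop (by omega) (.nest (by omega) (polyTime_relax (by omega))))
      ((PolyTime.nest (by omega) (polyTime_clear (by omega))).of_le (by omega)))) .skip

theorem BestSound.congr {s' : State} (h : J.BestSound s) (hs : SameBest s s') :
    J.BestSound s' := by
  rwa [BestSound, hs.1, hs.2]

/-- The final value lies between two bounds: it is at most the robust value of the recorded set, and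
at least that of any feasible `T`, seen at the guess which `exists_guess` provides for `T`. -/
theorem nest_tryGuess (hs : J.Holds s) (hB : J.BestSound s) :
    J.Holds (nest tryGuess 1 4 s) ∧ ∃ S, (nest tryGuess 1 4 s).natArr 6 0 = mask S ∧
      IsOptimalFirstStage J.feasible J.weights S := by
  have := nest_spec (n := n) (g := tryGuess) (r := 4) (l := 1)
    (Core := fun s s' => s.real 0 ≤ s'.real 0)
    (Q := fun v s => J.Valid ⟨v 1, v 2, v 3, v 4⟩ → ∀ k ≤ n, ∀ f ≤ n, ∀ e ≤ n, ∀ S,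
      J.Reach ⟨v 1, v 2, v 3, v 4⟩ k f e S →
        totalWeight J.weights S - (J.weight (v 3) - J.weight (v 4)) ≤ s.real 0)
    le_trans (fun s x v => le_rfl)
    (fun h hQ hθ k hk f hf e he S hr => (hQ hθ k hk f hf e he S hr).trans h)
    (by omega) polyTime_tryGuess
    (Inv := fun s => J.Holds s ∧ J.BestSound s)
    (fun s x v hx hx' hs => ⟨hs.1.setNat (by omega) v, hs.2⟩) (fun s hs => hs.1.nat_zero)
    (fun s₁ ⟨hs₁, hB₁⟩ hb => by
      set θ : Guess := ⟨s₁.nat 1, s₁.nat 2, s₁.nat 3, s₁.nat 4⟩ with hθ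
      have hg : J.HoldsGuess θ s₁ := ⟨hs₁, rfl, rfl, rfl, rfl⟩
      by_cases hV : J.Valid θ
      · rw [tryGuess, if_pos (hg.validTest_holds.mpr hV)]
        obtain ⟨a₁, a₂, a₃, a₄⟩ := nest_clear hg
        obtain ⟨b₁, b₂, b₃, b₄⟩ := loop_nest_relax a₁ a₃ a₄
        obtain ⟨c₁, c₂, c₃, c₄⟩ := nest_record b₁ b₃
          (fun j hj => b₄ j (by omega)) ((hB₁.congr a₂).congr b₂) hV
          (hb 1 (by omega) (by omega)) (hb 2 (by omega) (by omega))
        refine ⟨⟨c₁, c₂⟩, ?_, fun v hv _ => ?_⟩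
        · rw [← a₂.1, ← b₂.1]
          exact c₃
        · rw [hv 1 (by omega), hv 2 (by omega), hv 3 (by omega), hv 4 (by omega)]
          exact c₄
      · rw [tryGuess, if_neg (fun h => hV (hg.validTest_holds.mp h))]
        refine ⟨⟨hs₁, hB₁⟩, le_rfl, fun v hv hV' => absurd hV' ?_⟩
        rwa [hv 1 (by omega), hv 2 (by omega), hv 3 (by omega), hv 4 (by omega)])
    s ⟨hs, hB⟩
  obtain ⟨⟨h₁, S, hS, hm, hv⟩, -, h₂⟩ := this
  refine ⟨h₁, S, hm, hS, fun T hT => le_trans ?_ hv⟩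
  obtain ⟨θ, ⟨b₁, b₂, b₃, b₄⟩, hθ, hval, k, hk, f, hf, e, he, hr⟩ := exists_guess hT
  rw [hval]
  refine h₂ (fun i => if i = 1 then θ.e₁ else if i = 2 then θ.e₂ else if i = 3 then θ.p else
    if i = 4 then θ.q else s.nat i) (fun i hi => ?_) (fun i hi hi' => ?_) hθ k hk f hf e he T hr
  · simp [show i ≠ 1 by omega, show i ≠ 2 by omega, show i ≠ 3 by omega, show i ≠ 4 by omega]
  · obtain rfl | rfl | rfl | rfl : i = 1 ∨ i = 2 ∨ i = 3 ∨ i = 4 := by omega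
    exacts [b₁, b₂, b₃, b₄]

end Jobs

namespace Jobs

variable {n : ℕ} {J : Jobs n} {s : State}

/-! ### Decoding of the bit mask -/

open Classical in
/-- Decode bit `n - x` of the bit mask of the best solution, where `x` is the variable `1`. -/
def decodeBit (s : State) : State :=
  if (Test.natLt (.get 6 (.const 0)) (.get 3 (.sub (.var 0) (.var 1)))).Holds s then
    s.putNat 2 ((NatExp.sub (.var 0) (.var 1)).eval s) ((NatExp.const 0).eval s)
  else
    ((fun s => s.putNat 6 ((NatExp.const 0).eval s) ((NatExp.sub (.get 6 (.const 0))
        (.get 3 (.sub (.var 0) (.var 1)))).eval s)) ∘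
      fun s => s.putNat 2 ((NatExp.sub (.var 0) (.var 1)).eval s) ((NatExp.const 1).eval s)) s

theorem polyTime_decodeBit {l : ℕ} (hl : 0 < l) : PolyTime l decodeBit :=
  .ite _ (.putNat 2 _ _) (.comp hl (.putNat 6 _ _) (.putNat 2 _ _))

/-- Lower bits sum to less than the next power of two, so one comparison reads off the top bit. -/
theorem mask_lt {T : Finset (Fin n)} {m : ℕ} (hT : ∀ j ∈ T, (j : ℕ) < m) : mask T < 2 ^ m := by
  have := Nat.geomSum_lt (m := 2) (n := m) (s := T.map Fin.valEmbedding) le_rfl (by simpa using hT)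
  simpa [mask] using this

theorem output_loop_decodeBit {S : Finset (Fin n)} (hs : J.Holds s) (hS : s.natArr 6 0 = mask S) :
    output n (loop 1 decodeBit s) = S := by
  have := loop_induction (x := 1) (g := decodeBit) hs.nat_zero
    -- Bits are removed from the top: after `k` rounds the bits up to `n - k` remain. Round `0`
    -- inspects bit `n`, which is never set, and writes an entry that `output` ignores.
    (fun k s' => J.Holds s' ∧
      s'.natArr 6 0 = mask (S.filter fun j : Fin n => (j : ℕ) + k ≤ n) ∧
      ∀ j : Fin n, n < j + k → (s'.natArr 2 j = 1 ↔ j ∈ S))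
    ⟨hs.setNat (by omega) _, by
      rw [Finset.filter_true_of_mem fun j _ => by omega]; exact hS, fun j hj => by omega⟩
    (fun k s' hk hs'k ⟨h₁, h₂, h₃⟩ => by
      have hpow : s'.natArr 3 (n - k) = 2 ^ (n - k) := h₁.pow _ (by omega)
      set T := S.filter fun j : Fin n => (j : ℕ) + (k + 1) ≤ n with hT
      have hTlt : mask T < 2 ^ (n - k) := mask_lt fun j hj => by
        have := (Finset.mem_filter.mp hj).2
        omega
      have hiff : (Test.natLt (.get 6 (.const 0)) (.get 3 (.sub (.var 0) (.var 1)))).Holds s' ↔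
          mask (S.filter fun j : Fin n => (j : ℕ) + k ≤ n) < 2 ^ (n - k) := by
        simp [h₂, hs'k, h₁.nat_zero, hpow]
      by_cases hj : ∃ j ∈ S, (j : ℕ) + k = n
      · obtain ⟨j, hjS, hj⟩ := hj
        have hins : (S.filter fun j : Fin n => (j : ℕ) + k ≤ n) = insert j T := by
          ext i
          simp only [hT, Finset.mem_filter, Finset.mem_insert, Fin.ext_iff]
          constructor
          · rintro ⟨h, h'⟩
            by_cases hij : (i : ℕ) = j
            · exact Or.inl hij
            · exact Or.inr ⟨h, by omega⟩
          · rintro (h | ⟨h, h'⟩)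
            · rw [Fin.ext h]
              exact ⟨hjS, by omega⟩
            · exact ⟨h, by omega⟩
        have hjT : j ∉ T := fun h => by
          have := (Finset.mem_filter.mp h).2
          omega
        have hjk : (j : ℕ) = n - k := by omega
        have hm : mask (S.filter fun j : Fin n => (j : ℕ) + k ≤ n) = 2 ^ (n - k) + mask T := by
          rw [hins, mask, Finset.sum_insert hjT, hjk, mask]
        rw [decodeBit, if_neg (by rw [hiff, hm]; omega)]
        refine ⟨((h₁.putNat (by omega) _ _).putNat (by omega) _ _).setNat (by omega) _, ?_,
          fun i hi => ?_⟩
        · simp [h₂, hm, h₁.nat_zero, hs'k, hpow]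
        · simp only [Function.comp, State.setNat_natArr, State.putNat_natArr, NatExp.eval,
            h₁.nat_zero, hs'k]
          by_cases hij : i = j
          · simp [hij, hjk, hjS]
          · have : (i : ℕ) ≠ n - k := fun h => hij (Fin.ext (h.trans hjk.symm))
            simp [this, h₃ i (by omega)]
      · have hins : (S.filter fun j : Fin n => (j : ℕ) + k ≤ n) = T := by
          refine Finset.filter_congr fun i hi => ?_
          have : (i : ℕ) + k ≠ n := fun h => hj ⟨i, hi, h⟩
          omega
        rw [decodeBit, if_pos (by rw [hiff, hins]; exact hTlt)]
        refine ⟨(h₁.putNat (by omega) _ _).setNat (by omega) _, ?_, fun i hi => ?_⟩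
        · simp [h₂, hins]
        · simp only [State.setNat_natArr, State.putNat_natArr, NatExp.eval, h₁.nat_zero, hs'k]
          by_cases hij : (i : ℕ) = n - k
          · have : i ∉ S := fun h => hj ⟨i, h, by omega⟩
            simp [hij, this]
          · simp [hij, h₃ i (by omega)])
  ext j
  simpa [output] using this.2.2 j (by omega)

end Jobs

/-! ### Preparation -/

/-- Add a right end point to the variable `10`. -/
def addRight (s : State) : State :=
  s.setNat 10 ((NatExp.add (.var 10) (.get 1 (.var 1))).eval s)

/-- The test whether the interval of the job in the variable `1` is empty. -/
def emptyTest : Test :=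
  .and (.natLt (.var 1) (.var 0)) (.not (.natLt (.get 0 (.var 1)) (.get 1 (.var 1))))

open Classical in
/-- If the interval of the job in the variable `1` is empty, replace it by one of length `1` beyond
all given intervals. -/
def fill (s : State) : State :=
  if emptyTest.Holds s then
    ((fun s => s.putNat 1 ((NatExp.var 1).eval s)
        ((NatExp.add (.get 0 (.var 1)) (.const 1)).eval s)) ∘
      fun s => s.putNat 0 ((NatExp.var 1).eval s) ((NatExp.add (.var 10) (.var 1)).eval s)) s
  else s

/-- Compute the next power of two and the next multiple of `n + 1`. -/
def nextEntry : State → State :=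
  (fun s => s.putNat 4 ((NatExp.add (.var 1) (.const 1)).eval s)
      ((NatExp.add (.get 4 (.var 1)) (.add (.var 0) (.const 1))).eval s)) ∘
    fun s => s.putNat 3 ((NatExp.add (.var 1) (.const 1)).eval s)
      ((NatExp.add (.get 3 (.var 1)) (.get 3 (.var 1))).eval s)

/-- Compute the intervals of the jobs and the auxiliary tables. -/
def prepare : State → State :=
  loop 1 nextEntry ∘
    (fun s => s.putNat 3 ((NatExp.const 0).eval s) ((NatExp.const 1).eval s)) ∘
      loop 1 fill ∘ loop 1 addRight

theorem polyTime_fill {l : ℕ} (hl : 0 < l) : PolyTime l fill :=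
  .ite _ (.comp hl (.putNat 1 _ _) (.putNat 0 _ _)) .skip

theorem polyTime_nextEntry {l : ℕ} (hl : 0 < l) : PolyTime l nextEntry :=
  .comp hl (.putNat 4 _ _) (.putNat 3 _ _)

theorem polyTime_prepare : PolyTime 1 prepare :=
  .comp one_pos (.loop one_pos (polyTime_nextEntry (by omega)))
    (.comp one_pos (.putNat 3 _ _) (.comp one_pos
      (.loop one_pos (polyTime_fill (by omega))) (.loop one_pos (.setNat (by omega) _))))

/-! ### From a given instance to jobs with non-empty intervals -/

namespace Instance

variable {n : ℕ} (I : Instance n)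

/-- A bound on all right end points. -/
def bound : ℕ := ∑ i ∈ Finset.range (n + 1), I.input.natArr 1 i

/-- The jobs of an instance; empty intervals are replaced by intervals of length `1` beyond all
given intervals. -/
def jobs : Jobs n where
  left j := if j < n ∧ ¬ I.input.natArr 0 j < I.input.natArr 1 j then I.bound + j
    else I.input.natArr 0 j
  right j := if j < n ∧ ¬ I.input.natArr 0 j < I.input.natArr 1 j then I.bound + j + 1
    else I.input.natArr 1 j
  weight j := I.input.realArr 0 j
  left_lt_right j hj := by
    split_ifs with h
    · omega
    · exact not_not.mp fun h' => h ⟨hj, h'⟩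
  -- The arrays are zero outside the input, so index `n` is a dummy job at no expense.
  left_self := by simp [input]
  right_self := by simp [input]
  weight_self := by simp [input]
  weight_nonneg j := by
    by_cases hj : j < n <;> simp [input, hj, I.weight_nonneg]

theorem weights_jobs : I.jobs.weights = I.weight := by
  ext j
  simp [Jobs.weights, jobs, input]

theorem right_le_bound (j : Fin n) : I.right j ≤ I.bound := by
  have := Finset.single_le_sum (f := I.input.natArr 1) (fun _ _ => Nat.zero_le _)
    (Finset.mem_range.mpr (j.2.trans n.lt_succ_self))
  rw [bound]
  refine le_trans (le_of_eq ?_) this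
  simp [input]

/-- An empty interval is disjoint from every interval; its substitute `[bound + j, bound + j + 1)`
lies beyond all given intervals and misses the other substitutes. Distinctness matters, as an empty
interval is disjoint even from itself. -/
theorem disjoint_interval_iff {i j : Fin n} (hij : i ≠ j) :
    Disjoint (I.interval i) (I.interval j) ↔ I.jobs.Compat i j := by
  have hij' : (i : ℕ) ≠ j := fun h => hij (Fin.ext h)
  have hi := I.left_le_right i
  have hj := I.left_le_right j
  have hi' := I.right_le_bound i
  have hj' := I.right_le_bound j
  have key : Disjoint (I.interval i) (I.interval j) ↔
      min (I.right i) (I.right j) ≤ max (I.left i) (I.left j) := by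
    rw [interval, interval, Set.Ico_disjoint_Ico]
    norm_cast
  rw [key]
  simp only [Jobs.Compat, Jobs.Prec, jobs, input, Fin.is_lt, dite_true, if_true, true_and,
    one_ne_zero, if_false, Fin.eta]
  split_ifs <;> omega

theorem feasible_jobs : I.jobs.feasible = I.feasible := by
  ext S
  refine ⟨fun h i hi j hj hij => (I.disjoint_interval_iff hij).mpr (h i hi j hj hij),
    fun h i hi j hj hij => (I.disjoint_interval_iff hij).mp (h hi hj hij)⟩

theorem loop_addRight : (loop 1 addRight I.input).nat 0 = n ∧
    (loop 1 addRight I.input).nat 10 = I.bound ∧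
    (loop 1 addRight I.input).natArr = I.input.natArr ∧
    (loop 1 addRight I.input).real = I.input.real ∧
    (loop 1 addRight I.input).realArr = I.input.realArr :=
  loop_induction (n := n) (by simp [input])
    (fun k s => s.nat 0 = n ∧ s.nat 10 = ∑ i ∈ Finset.range k, I.input.natArr 1 i ∧
      s.natArr = I.input.natArr ∧ s.real = I.input.real ∧ s.realArr = I.input.realArr)
    (by simp [input]) fun k s hk hsk ⟨h₁, h₂, h₃, h₄, h₅⟩ => by
      refine ⟨by simp [addRight, h₁], ?_, h₃, h₄, h₅⟩
      simp [addRight, h₂, h₃, hsk, Finset.sum_range_succ]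

theorem loop_fill {s : State} (h₁ : s.nat 0 = n) (h₂ : s.nat 10 = I.bound)
    (h₃ : s.natArr = I.input.natArr) :
    (loop 1 fill s).nat 0 = n ∧ (loop 1 fill s).natArr 0 = I.jobs.left ∧
      (loop 1 fill s).natArr 1 = I.jobs.right ∧
      (∀ a, 1 < a → (loop 1 fill s).natArr a = I.input.natArr a) ∧
      (loop 1 fill s).real = s.real ∧ (loop 1 fill s).realArr = s.realArr := by
  have := loop_induction (x := 1) (g := fill) h₁
    (fun k s' => s'.nat 0 = n ∧ s'.nat 10 = I.bound ∧
      -- The replacement is done in place: entries below `k` are final, the others still equal the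
      -- input, so each emptiness test sees original end points.
      (∀ i, s'.natArr 0 i = if i < k then I.jobs.left i else I.input.natArr 0 i) ∧
      (∀ i, s'.natArr 1 i = if i < k then I.jobs.right i else I.input.natArr 1 i) ∧
      (∀ a, 1 < a → s'.natArr a = I.input.natArr a) ∧ s'.real = s.real ∧ s'.realArr = s.realArr)
    (by simp [h₁, h₂, h₃]) (fun k s' hk hs'k ⟨g₁, g₂, g₃, g₄, g₅, g₆, g₇⟩ => by
      have hiff : emptyTest.Holds s' ↔ k < n ∧ ¬ I.input.natArr 0 k < I.input.natArr 1 k := by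
        simp [emptyTest, hs'k, g₁, g₃, g₄]
      by_cases hE : emptyTest.Holds s'
      · have hE' := hiff.mp hE
        rw [fill, if_pos hE]
        refine ⟨by simp [g₁], by simp [g₂], fun i => ?_, fun i => ?_, fun a ha => ?_, g₆, g₇⟩
        · rcases lt_trichotomy i k with h | rfl | h
          · simp [hs'k, h.ne, g₃, h, h.trans k.lt_succ_self]
          · simp [hs'k, g₂, jobs, hE']
          · simp [hs'k, h.ne', g₃, h.not_gt, show ¬ i < k + 1 by omega]
        · rcases lt_trichotomy i k with h | rfl | h
          · simp [hs'k, h.ne, g₄, h, h.trans k.lt_succ_self]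
          · simp [hs'k, g₂, jobs, hE']
          · simp [hs'k, h.ne', g₄, h.not_gt, show ¬ i < k + 1 by omega]
        · simp [show a ≠ 0 by omega, show a ≠ 1 by omega, g₅ a ha]
      · have hE' := fun h => hE (hiff.mpr h)
        rw [fill, if_neg hE]
        refine ⟨by simp [g₁], by simp [g₂], fun i => ?_, fun i => ?_, g₅, g₆, g₇⟩
        · rcases lt_trichotomy i k with h | rfl | h
          · simp [g₃, h, h.trans k.lt_succ_self]
          · simp only [State.setNat_natArr, g₃, lt_irrefl, if_false, lt_add_one, if_true, jobs]
            rw [if_neg hE']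
          · simp [g₃, h.not_gt, show ¬ i < k + 1 by omega]
        · rcases lt_trichotomy i k with h | rfl | h
          · simp [g₄, h, h.trans k.lt_succ_self]
          · simp only [State.setNat_natArr, g₄, lt_irrefl, if_false, lt_add_one, if_true, jobs]
            rw [if_neg hE']
          · simp [g₄, h.not_gt, show ¬ i < k + 1 by omega])
  obtain ⟨g₁, -, g₃, g₄, g₅, g₆, g₇⟩ := this
  refine ⟨g₁, funext fun i => ?_, funext fun i => ?_, g₅, g₆, g₇⟩
  · rw [g₃]
    split_ifs with h
    · rfl
    · simp [jobs, show ¬ i < n by omega]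
  · rw [g₄]
    split_ifs with h
    · rfl
    · simp [jobs, show ¬ i < n by omega]

theorem holds_prepare : I.jobs.Holds (prepare I.input) ∧ (prepare I.input).natArr 6 0 = 0 ∧
    (prepare I.input).real 0 = 0 := by
  obtain ⟨a₁, a₂, a₃, a₄, a₅⟩ := I.loop_addRight
  obtain ⟨b₁, b₂, b₃, b₄, b₅, b₆⟩ := I.loop_fill a₁ a₂ a₃
  have := loop_induction (n := n) (x := 1) (g := nextEntry)
    (s := ((loop 1 fill ∘ loop 1 addRight) I.input).putNat 3 0 1) b₁
    (fun k s => s.nat 0 = n ∧ s.natArr 0 = I.jobs.left ∧ s.natArr 1 = I.jobs.right ∧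
      s.realArr 0 = I.jobs.weight ∧ (∀ i ≤ k, s.natArr 3 i = 2 ^ i) ∧
      (∀ i ≤ k, s.natArr 4 i = i * (n + 1)) ∧ s.natArr 6 0 = 0 ∧ s.real 0 = 0)
    (by
      refine ⟨by simp [b₁], by simp [b₂], by simp [b₃], by simp [b₆, a₅]; rfl, by simp,
        fun i hi => ?_, ?_, ?_⟩
      · simp [Nat.le_zero.mp hi, b₄ 4 (by omega)]; simp [input]
      · simp [b₄ 6 (by omega)]; simp [input]
      · simp [b₅, a₄]; simp [input])
    (fun k s hk hsk ⟨c₁, c₂, c₃, c₄, c₅, c₆, c₇, c₈⟩ => by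
      refine ⟨by simp [nextEntry, c₁], by simp [nextEntry, c₂], by simp [nextEntry, c₃],
        by simp [nextEntry, c₄], fun i hi => ?_, fun i hi => ?_, by simp [nextEntry, c₇],
        by simp [nextEntry, c₈]⟩
      · rcases hi.eq_or_lt with rfl | hi
        · simp [nextEntry, hsk, c₅ k le_rfl, pow_succ, mul_two]
        · simp [nextEntry, hsk, hi.ne, c₅ i (by omega)]
      · rcases hi.eq_or_lt with rfl | hi
        · simp [nextEntry, hsk, c₁, c₆ k le_rfl, add_mul]
        · simp [nextEntry, hsk, hi.ne, c₆ i (by omega)])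
  obtain ⟨c₁, c₂, c₃, c₄, c₅, c₆, c₇, c₈⟩ := this
  exact ⟨⟨c₁, c₂, c₃, c₄, fun i hi => c₅ i (by omega), fun i hi => c₆ i (by omega)⟩, c₇, c₈⟩

/-- Before the first guess, the best solution is the empty one. -/
theorem bestSound_prepare : I.jobs.BestSound (prepare I.input) := by
  refine ⟨∅, Jobs.empty_mem_feasible, by simp [I.holds_prepare.2.1, Jobs.mask], ?_⟩
  rw [I.holds_prepare.2.2,
    le_robustValue_iff Jobs.isLowerSet_feasible Jobs.empty_mem_feasible]
  exact fun f => ⟨none, admissible_none Jobs.isLowerSet_feasible Jobs.empty_mem_feasible f,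
    -- Non-negative weights enter here: they justify `0` as the initial best value.
    Finset.sum_nonneg fun j _ => I.jobs.weight_nonneg j⟩

end Instance

/-! ### Assembly of the algorithm -/

/-- The algorithm for robust interval scheduling. -/
def solve : State → State := loop 1 Jobs.decodeBit ∘ nest Jobs.tryGuess 1 4 ∘ prepare

theorem polyTime_solve : PolyTime 1 solve :=
  .comp one_pos (.loop one_pos (Jobs.polyTime_decodeBit (by omega)))
    (.comp one_pos (.nest one_pos Jobs.polyTime_tryGuess) polyTime_prepare)

theorem isOptimalFirstStage_output_solve {n : ℕ} (I : Instance n) :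
    IsOptimalFirstStage I.feasible I.weight (output n (solve I.input)) := by
  obtain ⟨h, S, hm, hS⟩ := Jobs.nest_tryGuess I.holds_prepare.1 I.bestSound_prepare
  rw [solve, Function.comp, Function.comp, Jobs.output_loop_decodeBit h hm]
  rwa [I.feasible_jobs, I.weights_jobs] at hS

end RobustIntervalScheduling

end

theorem theorem6p1 :
    ∃ (P : RobustIntervalScheduling.Program) (p : Polynomial ℕ),
      ∀ (n : ℕ) (I : RobustIntervalScheduling.Instance n),
        ∃ (s : RobustIntervalScheduling.State) (t : ℕ),
          RobustIntervalScheduling.Exec P I.input s t ∧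
          t ≤ p.eval n ∧
          RobustIntervalScheduling.IsOptimalFirstStage I.feasible I.weight
            (RobustIntervalScheduling.output n s) := by
  obtain ⟨P, p, hP⟩ := RobustIntervalScheduling.polyTime_solve.exec
  refine ⟨P, p, fun n I => ?_⟩
  obtain ⟨t, ht, he⟩ := hP I.input
  exact ⟨_, t, he, ht, RobustIntervalScheduling.isOptimalFirstStage_output_solve I⟩
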